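/- **Network.** An access point (AP) serves $N$ devices, $\mathcal N=\{1,\dots,N\}=\mathcal N_1\sqcup\mathcal N_2$ (Type I / Type II), in slots $t=0,1,2,\dots$ of duration $T>0$. Fix $W,P_0,N_0,V>0$, $\xi_i\in(0,1)$, and for $i\in\mathcal N_2$ a maximum transmit power $P_i^{\max}>0$ and a battery capacity $\theta_i>0$. The network state of slot $t$ consists of channel gains $h_i(t)\ge 0$, available data $A_i(t)\in[0,A_i^{\max}]$ and AP processing speeds $r_i(t)\in[0,r_i^{\max}]$; the states $(h(t),A(t),r(t))$ are i.i.d. over the slots. A decision consists of time portions $\mu_0(t),\mu_i(t)$, transmit energies $e_i(t)$ ($i\in\mathcal N_2$) and collected data $a_i(t)$ with $$\text{(1) } \mu_0,\mu_i\ge 0,\ \mu_0+\sum_i\mu_i\le 1;\qquad \text{(2) } 0\le e_i\le P_i^{\max}\mu_iT\ (i\in\mathcal N_2);\qquad \text{(3) } 0\le a_i\le A_i.$$ Put $e_i^H=\xi_iP_0h_i\mu_0T$ and $c_i=\mu_iTW\log_2(1+P_ih_i/N_0)$, where $P_i=e_i/(\mu_iT)$ for $i\in\mathcal N_2$ and $P_i=e_i^H/(\mu_iT)$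 for $i\in\mathcal N_1$ (and $P_i=0$ if $\mu_i=0$). Almost surely $c_i\le c_i^{\max}$ and $e_i^H\le e_{i,\max}^H$ for all decisions with (1), (2). From deterministic initial values $Q_i(0),S_i(0)\ge 0$, $E_i(0)\in[0,\theta_i]$, $$Q_i(t+1)=[Q_i(t)-c_i(t)]^++a_i(t),\qquad S_i(t+1)=[S_i(t)-r_i(t)]^++\min\{c_i(t),Q_i(t)\},$$ $$E_i(t+1)=\min\{E_i(t)+e_i^H(t),\theta_i\}-e_i(t)\quad(i\in\mathcal N_2).$$ **Offline problem $\mathbf P$.** Over all (also non-causal) random decision processes that almost surely satisfy (1), (2), (3) and $e_i(t)\le E_i(t)+e_i^H(t)$ for $i\in\mathcal N_2$ in every slot, and for which $\limsup_t\frac1t\sum_{\tau<t}\mathbb E\,Q_i(\tau)<\infty$ and $\limsup_t\frac1t\sum_{\tau<t}\mathbb E\,S_i(\tau)<\infty$ for all $i$, let $U^\star$ be the supremum of $\limsup_{t}\frac1t\sum_{\tau<t}\mathbb E\sum_i\log(1+a_i(\tau))$. **ERS-RN algorithm.** In every slot let $\mathcal N_t=\{i: S_i(t)\ge Q_i(t)\}$.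 The devices in $\mathcal N_t$ are silent ($\mu_i=0$, and $e_i=0$ for $i\in\mathcal N_2$). The variables $\mu_0$, $\mu_i$ ($i\notin\mathcal N_t$), $e_i$ ($i\in\mathcal N_2\setminus\mathcal N_t$) minimize, subject to (1) and (2) for these variables, $$\sum_{i\in\mathcal N_2\setminus\mathcal N_t}\bigl(D_i\phi_i-(E_i-\theta_i)e_i\bigr)+\sum_{i\in\mathcal N_1\setminus\mathcal N_t}D_i\psi_i+\mu_0TP_0\sum_{i\in\mathcal N_2}(E_i-\theta_i)\xi_ih_i ,$$ where $D_i=(S_i-Q_i)TW$, $\phi_i=\mu_i\log_2\bigl(1+\frac{h_i}{N_0T}\frac{e_i}{\mu_i}\bigr)$, $\psi_i=\mu_i\log_2\bigl(1+\frac{\xi_iP_0h_i^2}{N_0}\frac{\mu_0}{\mu_i}\bigr)$ (both $0$ at $\mu_i=0$). Moreover $a_i=A_i$ if $V\ge(A_i+1)Q_i$, and $a_i=[V/Q_i-1]^+$ otherwise. Minimizers are chosen causally (future states are independent of the decisions made so far). Let $U^*=\liminf_t\frac1t\sum_{\tau<t}\mathbb E\sum_i\log(1+a_i(\tau))$ for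 the resulting process. **Theorem.** Suppose that $\mathbf P$ is feasible. Then $U^\star-U^*\le B_1/V$, where $$B_1=\tfrac12\Bigl\{\sum_{i\in\mathcal N}\bigl[(A_i^{\max})^2+(r_i^{\max})^2\bigr]+2\sum_{i\in\mathcal N}(c_i^{\max})^2\Bigr\}+\tfrac12\sum_{i\in\mathcal N_2}\bigl[(e_{i,\max}^H)^2+(P_i^{\max}T)^2\bigr].$$ -/

import Mathlib

open MeasureTheory ProbabilityTheory Filter

namespace WPMEC

noncomputable section

/-! ### Network parameters, network state, decisions -/

/-- Deterministic parameters of the wireless powered MEC network with `N` devices. The devices in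
`N₂` are of Type II (with battery), the other ones are of Type I. The entries of `Pmax`, `θ`, `E₀`
at Type-I devices are not used. -/
structure Params (N : ℕ) where
  /-- set of Type-II devices -/
  N₂ : Finset (Fin N)
  /-- slot duration -/
  T : ℝ
  /-- bandwidth -/
  W : ℝ
  /-- transmit power of the access point -/
  P₀ : ℝ
  /-- noise power at the access point -/
  N₀ : ℝ
  /-- energy harvesting efficiencies -/
  ξ : Fin N → ℝ
  /-- maximal transmit powers of Type-II devices -/
  Pmax : Fin N → ℝ
  /-- battery capacities of Type-II devices, also the perturbation weights -/
  θ : Fin N → ℝ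
  /-- control parameter -/
  V : ℝ
  /-- bound of the data that can be collected in one slot -/
  Amax : Fin N → ℝ
  /-- bound of the processing speed of the access point -/
  rmax : Fin N → ℝ
  /-- bound of the data that can be offloaded in one slot -/
  cmax : Fin N → ℝ
  /-- bound of the energy harvested in one slot -/
  eHmax : Fin N → ℝ
  /-- initial data backlog of the devices -/
  Q₀ : Fin N → ℝ
  /-- initial data backlog of the access point -/
  S₀ : Fin N → ℝ
  /-- initial energy of Type-II devices -/
  E₀ : Fin N → ℝ
  T_pos : 0 < T
  W_pos : 0 < W
  P₀_pos : 0 < P₀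
  N₀_pos : 0 < N₀
  ξ_mem : ∀ i, ξ i ∈ Set.Ioo (0 : ℝ) 1
  Pmax_pos : ∀ i ∈ N₂, 0 < Pmax i
  θ_pos : ∀ i ∈ N₂, 0 < θ i
  V_pos : 0 < V
  Q₀_nonneg : ∀ i, 0 ≤ Q₀ i
  S₀_nonneg : ∀ i, 0 ≤ S₀ i
  E₀_mem : ∀ i ∈ N₂, E₀ i ∈ Set.Icc (0 : ℝ) (θ i)

/-- Network state of one slot: channel power gains `h`, available data `A`, processing speeds `r`
of the access point. -/
abbrev NSI (N : ℕ) : Type := (Fin N → ℝ) × (Fin N → ℝ) × (Fin N → ℝ)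

def NSI.h {N : ℕ} (s : NSI N) : Fin N → ℝ := s.1
def NSI.A {N : ℕ} (s : NSI N) : Fin N → ℝ := s.2.1
def NSI.r {N : ℕ} (s : NSI N) : Fin N → ℝ := s.2.2

/-- Decision of one slot: time portion `μ₀` of the wireless power transfer, time portions `μ` of
the devices, transmit energies `e` (used at Type-II devices only), collected data `a`. -/
abbrev Decision (N : ℕ) : Type := ℝ × (Fin N → ℝ) × (Fin N → ℝ) × (Fin N → ℝ)

def Decision.μ₀ {N : ℕ} (x : Decision N) : ℝ := x.1
def Decision.μ {N : ℕ} (x : Decision N) : Fin N → ℝ := x.2.1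
def Decision.e {N : ℕ} (x : Decision N) : Fin N → ℝ := x.2.2.1
def Decision.a {N : ℕ} (x : Decision N) : Fin N → ℝ := x.2.2.2

variable {N : ℕ}

/-- Energy `e_i^H = ξ_i P₀ h_i μ₀ T` harvested in one slot. -/
def harvest (p : Params N) (s : NSI N) (x : Decision N) (i : Fin N) : ℝ :=
  p.ξ i * p.P₀ * s.h i * x.μ₀ * p.T

/-- Transmit power: a silent device has power `0`, a Type-II device spends `e_i`, a Type-I device
spends all the energy harvested in the slot. -/
def txPower (p : Params N) (s : NSI N) (x : Decision N) (i : Fin N) : ℝ :=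
  if x.μ i = 0 then 0
  else if i ∈ p.N₂ then x.e i / (x.μ i * p.T)
  else harvest p s x i / (x.μ i * p.T)

/-- Achievable offloading data size `c_i = μ_i T W log₂ (1 + P_i h_i / N₀)`. -/
def rate (p : Params N) (s : NSI N) (x : Decision N) (i : Fin N) : ℝ :=
  x.μ i * p.T * p.W * Real.logb 2 (1 + txPower p s x i * s.h i / p.N₀)

/-- The time portions are nonnegative with sum at most one. -/
def TimeOK (x : Decision N) : Prop :=
  0 ≤ x.μ₀ ∧ (∀ i, 0 ≤ x.μ i) ∧ x.μ₀ + ∑ i, x.μ i ≤ 1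

/-- Nonnegative transmit energies that obey the maximum transmit power constraint. -/
def PowerOK (p : Params N) (x : Decision N) : Prop :=
  ∀ i ∈ p.N₂, 0 ≤ x.e i ∧ x.e i ≤ p.Pmax i * x.μ i * p.T

/-- Only available data are collected. -/
def CollectOK (s : NSI N) (x : Decision N) : Prop :=
  ∀ i, 0 ≤ x.a i ∧ x.a i ≤ s.A i

/-! ### Queue dynamics along a sequence of states and decisions -/

/-- Data backlog of the devices: `Q_i(t+1) = [Q_i(t) - c_i(t)]⁺ + a_i(t)`. -/
def queueQ (p : Params N) (s : ℕ → NSI N) (x : ℕ → Decision N) : ℕ → Fin N → ℝ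
  | 0 => p.Q₀
  | t + 1 => fun i => max (queueQ p s x t i - rate p (s t) (x t) i) 0 + (x t).a i

/-- Data backlog of the access point: `S_i(t+1) = [S_i(t) - r_i(t)]⁺ + min {c_i(t), Q_i(t)}`. -/
def queueS (p : Params N) (s : ℕ → NSI N) (x : ℕ → Decision N) : ℕ → Fin N → ℝ
  | 0 => p.S₀
  | t + 1 => fun i => max (queueS p s x t i - (s t).r i) 0
      + min (rate p (s t) (x t) i) (queueQ p s x t i)

/-- Energy of the Type-II devices: `E_i(t+1) = min {E_i(t) + e_i^H(t), θ_i} - e_i(t)`. -/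
def energyE (p : Params N) (s : ℕ → NSI N) (x : ℕ → Decision N) : ℕ → Fin N → ℝ
  | 0 => p.E₀
  | t + 1 => fun i => min (energyE p s x t i + harvest p (s t) (x t) i) (p.θ i) - (x t).e i

/-- The energy-availability constraint at slot `t`. -/
def EnergyOK (p : Params N) (s : ℕ → NSI N) (x : ℕ → Decision N) (t : ℕ) : Prop :=
  ∀ i ∈ p.N₂, (x t).e i ≤ energyE p s x t i + harvest p (s t) (x t) i

/-! ### The stochastic network -/

/-- Standing assumptions on the random network states: they are i.i.d. over the slots (with
arbitrary dependence inside one slot), `h, A, r` are nonnegative, and `A_i`, `r_i` as well as the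
offloading sizes and the harvested energies of all admissible decisions have the stated bounds. -/
structure IsNetwork {Ω : Type*} [MeasurableSpace Ω] (P : Measure Ω) (p : Params N)
    (s : ℕ → Ω → NSI N) : Prop where
  meas : ∀ t, Measurable (s t)
  indep : iIndepFun s P
  ident : ∀ t, IdentDistrib (s t) (s 0) P P
  h_nonneg : ∀ t, ∀ᵐ ω ∂P, ∀ i, 0 ≤ (s t ω).h i
  A_mem : ∀ t, ∀ᵐ ω ∂P, ∀ i, (s t ω).A i ∈ Set.Icc 0 (p.Amax i)
  r_mem : ∀ t, ∀ᵐ ω ∂P, ∀ i, (s t ω).r i ∈ Set.Icc 0 (p.rmax i)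
  rate_le : ∀ t, ∀ᵐ ω ∂P, ∀ x : Decision N, TimeOK x → PowerOK p x →
    ∀ i, rate p (s t ω) x i ≤ p.cmax i
  harvest_le : ∀ t, ∀ᵐ ω ∂P, ∀ x : Decision N, TimeOK x →
    ∀ i, harvest p (s t ω) x i ≤ p.eHmax i

/-! ### Utility and the offline problem -/

/-- `(1/t) ∑_{τ < t} E ∑_i U_i(a_i(τ))` with `U_i(y) = log (1 + y)`. -/
def avgUtility {Ω : Type*} [MeasurableSpace Ω] (P : Measure Ω) (x : ℕ → Ω → Decision N)
    (t : ℕ) : ℝ :=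
  (∑ τ ∈ Finset.range t, ∫ ω, ∑ i, Real.log (1 + (x τ ω).a i) ∂P) / t

/-- Stability of a nonnegative backlog `X`: its time-average expectation is finite. -/
def StronglyStable {Ω : Type*} [MeasurableSpace Ω] (P : Measure Ω) (X : ℕ → Ω → ℝ) : Prop :=
  limsup (fun t : ℕ => (∑ τ ∈ Finset.range t, ∫⁻ ω, ENNReal.ofReal (X τ ω) ∂P) / (t : ENNReal))
    atTop < ⊤

/-- Feasible decision processes of the offline problem. There is no causality requirement: the
decision of a slot may depend on all past, present and future network states and on further
randomness. -/
structure OfflineFeasible {Ω : Type*} [MeasurableSpace Ω] (P : Measure Ω) (p : Params N)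
    (s : ℕ → Ω → NSI N) (x : ℕ → Ω → Decision N) : Prop where
  meas : ∀ t, Measurable (x t)
  time : ∀ t, ∀ᵐ ω ∂P, TimeOK (x t ω)
  energy : ∀ t, ∀ᵐ ω ∂P, EnergyOK p (fun τ => s τ ω) (fun τ => x τ ω) t
  power : ∀ t, ∀ᵐ ω ∂P, PowerOK p (x t ω)
  collect : ∀ t, ∀ᵐ ω ∂P, CollectOK (s t ω) (x t ω)
  stableQ : ∀ i, StronglyStable P fun t ω => queueQ p (fun τ => s τ ω) (fun τ => x τ ω) t i
  stableS : ∀ i, StronglyStable P fun t ω => queueS p (fun τ => s τ ω) (fun τ => x τ ω) t i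

/-- Offline optimum: the supremum of the long-term utility over all feasible processes. The upper
limit is the limit whenever that exists; the values lie in `[0, ∑ i, log (1 + Amax i)]`. -/
def offlineOptimum {Ω : Type*} [MeasurableSpace Ω] (P : Measure Ω) (p : Params N)
    (s : ℕ → Ω → NSI N) : ℝ :=
  sSup {u | ∃ x : ℕ → Ω → Decision N, OfflineFeasible P p s x ∧
    u = limsup (avgUtility P x) atTop}

/-- Long-term utility achieved by a decision process (the lower limit is the limit whenever that
exists). -/
def achievedUtility {Ω : Type*} [MeasurableSpace Ω] (P : Measure Ω)
    (x : ℕ → Ω → Decision N) : ℝ :=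
  liminf (avgUtility P x) atTop

/-! ### The ERS-RN algorithm -/

/-- Devices to be scheduled: those with `S_i < Q_i`; the other ones stay silent. -/
def active (Q S : Fin N → ℝ) : Finset (Fin N) :=
  Finset.univ.filter fun i => S i < Q i

/-- `φ_i = μ_i log₂ (1 + β_i e_i / μ_i)` with `β_i = h_i / (N₀ T)`. -/
def phi (p : Params N) (s : NSI N) (x : Decision N) (i : Fin N) : ℝ :=
  x.μ i * Real.logb 2 (1 + s.h i / (p.N₀ * p.T) * x.e i / x.μ i)

/-- `ψ_i = μ_i log₂ (1 + δ_i μ₀ / μ_i)` with `δ_i = ξ_i P₀ h_i² / N₀`. -/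
def psi (p : Params N) (s : NSI N) (x : Decision N) (i : Fin N) : ℝ :=
  x.μ i * Real.logb 2 (1 + p.ξ i * p.P₀ * s.h i ^ 2 / p.N₀ * x.μ₀ / x.μ i)

/-- Objective of the per-slot energy and time allocation problem at backlogs `Q`, `S`, energies `E`
and network state `s`, where `D_i = (S_i - Q_i) T W`. -/
def slotObjective (p : Params N) (Q S E : Fin N → ℝ) (s : NSI N) (x : Decision N) : ℝ :=
  ∑ i ∈ (active Q S).filter (· ∈ p.N₂), (S i - Q i) * p.T * p.W * phi p s x i
    - ∑ i ∈ (active Q S).filter (· ∈ p.N₂), (E i - p.θ i) * x.e i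
    + ∑ i ∈ (active Q S).filter (· ∉ p.N₂), (S i - Q i) * p.T * p.W * psi p s x i
    + x.μ₀ * p.T * p.P₀ * ∑ i ∈ p.N₂, (E i - p.θ i) * p.ξ i * s.h i

/-- Constraints of the per-slot problem; they concern `μ₀` and the active devices only. -/
def SlotFeasible (p : Params N) (Q S : Fin N → ℝ) (x : Decision N) : Prop :=
  0 ≤ x.μ₀ ∧ (∀ i ∈ active Q S, 0 ≤ x.μ i) ∧ x.μ₀ + ∑ i ∈ active Q S, x.μ i ≤ 1 ∧
    ∀ i ∈ active Q S, i ∈ p.N₂ → 0 ≤ x.e i ∧ x.e i ≤ p.Pmax i * x.μ i * p.T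

/-- `x` is a decision of the ERS-RN algorithm at backlogs `Q`, `S`, energies `E` and network state
`s`: it solves the per-slot problem, the other devices are silent, and data are collected by the
threshold rule. -/
structure IsERSDecision (p : Params N) (Q S E : Fin N → ℝ) (s : NSI N) (x : Decision N) :
    Prop where
  feasible : SlotFeasible p Q S x
  optimal : ∀ y : Decision N, SlotFeasible p Q S y →
    slotObjective p Q S E s x ≤ slotObjective p Q S E s y
  silent : ∀ i, i ∉ active Q S → x.μ i = 0 ∧ (i ∈ p.N₂ → x.e i = 0)
  collect : ∀ i, x.a i =
    if (s.A i + 1) * Q i ≤ p.V then s.A i else max (p.V / Q i - 1) 0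

/-- Causality: the decision of slot `t` is determined by information available at slot `t`, of
which the next network state is independent. -/
def Causal {Ω : Type*} [mΩ : MeasurableSpace Ω] (P : Measure Ω) (s : ℕ → Ω → NSI N)
    (x : ℕ → Ω → Decision N) : Prop :=
  ∃ ℱ : Filtration ℕ mΩ, ∀ t, Measurable[ℱ t] (s t) ∧ Measurable[ℱ t] (x t) ∧
    Indep (ℱ t) (MeasurableSpace.comap (s (t + 1)) inferInstance) P

/-- `x` is a run of the ERS-RN algorithm: a causal decision process whose decision in every slot is
one of the algorithm at the current backlogs, energies and network state. -/
structure IsERSRun {Ω : Type*} [MeasurableSpace Ω] (P : Measure Ω) (p : Params N)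
    (s : ℕ → Ω → NSI N) (x : ℕ → Ω → Decision N) : Prop where
  causal : Causal P s x
  decision : ∀ t, ∀ᵐ ω ∂P, IsERSDecision p
    (queueQ p (fun τ => s τ ω) (fun τ => x τ ω) t)
    (queueS p (fun τ => s τ ω) (fun τ => x τ ω) t)
    (energyE p (fun τ => s τ ω) (fun τ => x τ ω) t) (s t ω) (x t ω)

/-- The constant `B₁` of the drift bound. -/
def B₁ (p : Params N) : ℝ :=
  (1 / 2) * (∑ i, (p.Amax i ^ 2 + p.rmax i ^ 2) + 2 * ∑ i, p.cmax i ^ 2)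
    + (1 / 2) * ∑ i ∈ p.N₂, (p.eHmax i ^ 2 + (p.Pmax i * p.T) ^ 2)

end

end WPMEC

namespace WPMEC

noncomputable section

/-! ### One slot: offloading rates, optimality of the slot decision, Lyapunov drift. -/

section

variable {N : ℕ}

/-! The argument is drift-plus-penalty with the Lyapunov function ½(∑ (Q² + S²) + ∑ (E − θ)²).
Squaring the updates bounds its one-slot increment by `B₁` plus `slotCost` plus `V` times the
utility of the slot (`lyapunov_update_le`). The algorithm makes this cost small: the slot problem
controls its rate and energy part (`weighted_sum_le`), the threshold rule its collection part
(`collect_optimal`).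

The offline competitor may be non-causal, so no stationary policy is extracted from it. Instead, its
decision of slot `τ` is transplanted into slot `t`: the two network states have the same law, so the
conditional law of the decision given the state of slot `τ` can be evaluated at the state of slot
`t`. Causality makes the algorithm's backlogs independent of that state, hence the expected cost
splits into products of mean backlogs and mean increments of the competitor
(`integral_le_of_indepFun`, `integral_pathCost_le`).

Now fix `t` and average over `τ < n`. The increments telescope to terminal values divided by `n`;
these vanish for `Q` and `S` because strong stability with bounded downward steps forces sublinear
growth (`tendsto_div_of_average_le`), and for `E` a uniform lower bound suffices. What remains is
that the expected cost is at most `-V` times the competitor's utility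
(`integral_pathCost_le_limsup`). Summing the drift over `t` and dividing by `V t` leaves the gap `B₁
/ V` and an error of order `1 / t` (`le_avgUtility`). -/

lemma rate_nonneg (p : Params N) {s : NSI N} {x : Decision N} (hs : ∀ i, 0 ≤ s.h i)
    (ht : TimeOK x) (hp : PowerOK p x) (i : Fin N) : 0 ≤ rate p s x i := by
  have hμ := ht.2.1 i
  have hT := p.T_pos
  have hW := p.W_pos
  have hN := p.N₀_pos
  have hP := p.P₀_pos
  have hξ := (p.ξ_mem i).1
  have hh := hs i
  have h0 := ht.1
  have htx : 0 ≤ txPower p s x i := by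
    unfold txPower harvest
    split_ifs with h1 h2
    · exact le_rfl
    · exact div_nonneg (hp i h2).1 (by positivity)
    · positivity
  unfold rate
  refine mul_nonneg (by positivity) (Real.logb_nonneg (by norm_num) ?_)
  have : 0 ≤ txPower p s x i * s.h i / p.N₀ := by positivity
  linarith

lemma harvest_nonneg (p : Params N) {s : NSI N} {x : Decision N} (hs : ∀ i, 0 ≤ s.h i)
    (ht : TimeOK x) (i : Fin N) : 0 ≤ harvest p s x i := by
  have hT := p.T_pos
  have hP := p.P₀_pos
  have hξ := (p.ξ_mem i).1
  have hh := hs i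
  have h0 := ht.1
  unfold harvest
  positivity

lemma energy_le_of_powerOK (p : Params N) {x : Decision N} (ht : TimeOK x) (hp : PowerOK p x)
    {i : Fin N} (hi : i ∈ p.N₂) : x.e i ≤ p.Pmax i * p.T := by
  have h1 : x.μ i ≤ 1 := by
    have := Finset.single_le_sum (f := x.μ) (fun j _ => ht.2.1 j) (Finset.mem_univ i)
    linarith [ht.1, ht.2.2]
  have h2 := (hp i hi).2
  have h3 : 0 ≤ p.Pmax i * p.T := (mul_pos (p.Pmax_pos i hi) p.T_pos).le
  nlinarith

lemma phi_eq_rate (p : Params N) (s : NSI N) (x : Decision N) {i : Fin N} (hi : i ∈ p.N₂) :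
    p.T * p.W * phi p s x i = rate p s x i := by
  have hT := p.T_pos.ne'
  have hN := p.N₀_pos.ne'
  unfold phi rate txPower
  by_cases h : x.μ i = 0
  · simp [h]
  · rw [if_neg h, if_pos hi]
    have : s.h i / (p.N₀ * p.T) * x.e i / x.μ i = x.e i / (x.μ i * p.T) * s.h i / p.N₀ := by
      field_simp
    rw [this]; ring

lemma psi_eq_rate (p : Params N) (s : NSI N) (x : Decision N) {i : Fin N} (hi : i ∉ p.N₂) :
    p.T * p.W * psi p s x i = rate p s x i := by
  have hT := p.T_pos.ne'
  have hN := p.N₀_pos.ne'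
  unfold psi rate txPower harvest
  by_cases h : x.μ i = 0
  · simp [h]
  · rw [if_neg h, if_neg hi]
    have : p.ξ i * p.P₀ * s.h i ^ 2 / p.N₀ * x.μ₀ / x.μ i
        = p.ξ i * p.P₀ * s.h i * x.μ₀ * p.T / (x.μ i * p.T) * s.h i / p.N₀ := by
      field_simp
    rw [this]; ring

/-- Up to the factor `T W`, both `phi` and `psi` are the true offloading rate, also at `μ i = 0`,
where all of them vanish. The slot objective is therefore the rate and energy part of the drift
bound, except that transmit energies count at active devices only. -/
lemma slotObjective_eq (p : Params N) (Q S E : Fin N → ℝ) (s : NSI N) (x : Decision N) :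
    slotObjective p Q S E s x = ∑ i ∈ active Q S, (S i - Q i) * rate p s x i
      - ∑ i ∈ p.N₂, (if i ∈ active Q S then (E i - p.θ i) * x.e i else 0)
      + ∑ i ∈ p.N₂, (E i - p.θ i) * harvest p s x i := by
  have h1 : ∑ i ∈ (active Q S).filter (· ∈ p.N₂), (S i - Q i) * p.T * p.W * phi p s x i
      = ∑ i ∈ (active Q S).filter (· ∈ p.N₂), (S i - Q i) * rate p s x i :=
    Finset.sum_congr rfl fun i hi => by
      rw [← phi_eq_rate p s x (Finset.mem_filter.1 hi).2]; ring
  have h2 : ∑ i ∈ (active Q S).filter (· ∉ p.N₂), (S i - Q i) * p.T * p.W * psi p s x i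
      = ∑ i ∈ (active Q S).filter (· ∉ p.N₂), (S i - Q i) * rate p s x i :=
    Finset.sum_congr rfl fun i hi => by
      rw [← psi_eq_rate p s x (Finset.mem_filter.1 hi).2]; ring
  have h3 : x.μ₀ * p.T * p.P₀ * ∑ i ∈ p.N₂, (E i - p.θ i) * p.ξ i * s.h i
      = ∑ i ∈ p.N₂, (E i - p.θ i) * harvest p s x i := by
    rw [Finset.mul_sum]
    exact Finset.sum_congr rfl fun i _ => by unfold harvest; ring
  have h4 : ∑ i ∈ (active Q S).filter (· ∈ p.N₂), (E i - p.θ i) * x.e i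
      = ∑ i ∈ p.N₂, (if i ∈ active Q S then (E i - p.θ i) * x.e i else 0) := by
    rw [← Finset.sum_filter]
    refine Finset.sum_congr ?_ fun _ _ => rfl
    ext i; simp [and_comm]
  unfold slotObjective
  rw [h1, h2, h3, h4, ← Finset.sum_filter_add_sum_filter_not (active Q S) (· ∈ p.N₂)]
  ring

namespace IsERSDecision

variable {p : Params N} {Q S E : Fin N → ℝ} {s : NSI N} {x : Decision N}

lemma timeOK (h : IsERSDecision p Q S E s x) : TimeOK x := by
  refine ⟨h.feasible.1, fun i => ?_, ?_⟩
  · by_cases hi : i ∈ active Q S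
    · exact h.feasible.2.1 i hi
    · exact (h.silent i hi).1.ge
  · rw [← Finset.sum_subset (Finset.subset_univ (active Q S)) fun i _ hi => (h.silent i hi).1]
    exact h.feasible.2.2.1

lemma powerOK (h : IsERSDecision p Q S E s x) : PowerOK p x := by
  intro i hi
  by_cases ha : i ∈ active Q S
  · exact h.feasible.2.2.2 i ha hi
  · simp [(h.silent i ha).1, (h.silent i ha).2 hi]

lemma collectOK (h : IsERSDecision p Q S E s x) (hQ : ∀ i, 0 ≤ Q i) (hA : ∀ i, 0 ≤ s.A i) :
    CollectOK s x := by
  intro i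
  rw [h.collect i]
  have hA := hA i
  split_ifs with hc
  · exact ⟨hA, le_rfl⟩
  · refine ⟨le_max_right _ _, max_le ?_ hA⟩
    have hV := p.V_pos
    -- At `Q i = 0` the threshold test reads `0 ≤ V`, so this branch never divides by zero.
    have hQ0 : 0 < Q i := (hQ i).lt_of_ne fun h0 => by rw [← h0] at hc; simp at hc; linarith
    rw [sub_le_iff_le_add, div_le_iff₀ hQ0]
    linarith

/-- The threshold rule minimizes `Q a - V log (1 + a)` over `0 ≤ a ≤ A`. -/
lemma collect_optimal (h : IsERSDecision p Q S E s x) (hQ : ∀ i, 0 ≤ Q i)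
    (hA : ∀ i, 0 ≤ s.A i) (i : Fin N) {a : ℝ} (ha : 0 ≤ a) (haA : a ≤ s.A i) :
    Q i * x.a i - p.V * Real.log (1 + x.a i) ≤ Q i * a - p.V * Real.log (1 + a) := by
  have hV := p.V_pos
  have hb := h.collectOK hQ hA i
  set b := x.a i with hbdef
  have hb1 : 0 < 1 + b := by linarith [hb.1]
  -- Concavity: the logarithm lies below its tangent at the chosen amount `b`. The claim is thereby
  -- reduced to the first-order condition `key`, with the cases of `b` at the upper end, at zero,
  -- and at the stationary point `V = Q (1 + b)`.
  have hlog : Real.log (1 + a) - Real.log (1 + b) ≤ (a - b) / (1 + b) := by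
    rw [← Real.log_div (by linarith) hb1.ne']
    refine (Real.log_le_sub_one_of_pos (div_pos (by linarith) hb1)).trans (le_of_eq ?_)
    field_simp; ring
  have key : p.V * ((a - b) / (1 + b)) ≤ Q i * (a - b) := by
    have hrule := h.collect i
    rw [← hbdef] at hrule
    rw [mul_div_assoc', div_le_iff₀ hb1]
    split_ifs at hrule with hc
    · rw [hrule]
      nlinarith
    · have hQ0 : 0 < Q i := (hQ i).lt_of_ne fun h0 => by
        rw [← h0] at hc; simp at hc; linarith
      rcases le_total (p.V / Q i - 1) 0 with hle | hle
      · rw [max_eq_right hle] at hrule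
        have : p.V ≤ Q i := by
          rw [sub_nonpos, div_le_one hQ0] at hle; exact hle
        rw [hrule]; nlinarith
      · rw [max_eq_left hle] at hrule
        have : p.V = Q i * (1 + b) := by rw [hrule]; field_simp; ring
        rw [this]; linarith
  nlinarith [mul_le_mul_of_nonneg_left hlog hV.le]

/-- Silencing the devices with `S ≥ Q` loses nothing: their weight is nonnegative, so any offloaded
amount `m ≥ 0` costs at least zero. At active devices the weight is negative, so the full rate is at
least as good as a smaller `m`. The freedom in `m` is needed because the competitor really offloads
only the minimum of its rate and its own backlog. -/
lemma weighted_sum_le (h : IsERSDecision p Q S E s x)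
    (hE : ∀ i ∈ p.N₂, E i ≤ p.θ i)
    {d : Decision N} {m : Fin N → ℝ} (ht : TimeOK d) (hp : PowerOK p d)
    (hm : ∀ i, 0 ≤ m i ∧ m i ≤ rate p s d i) :
    ∑ i, (S i - Q i) * rate p s x i + ∑ i ∈ p.N₂, (E i - p.θ i) * (harvest p s x i - x.e i)
      ≤ ∑ i, (S i - Q i) * m i + ∑ i ∈ p.N₂, (E i - p.θ i) * (harvest p s d i - d.e i) := by
  have hd : SlotFeasible p Q S d := by
    refine ⟨ht.1, fun i _ => ht.2.1 i, ?_, fun i _ hi => hp i hi⟩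
    have := Finset.sum_le_sum_of_subset_of_nonneg (Finset.subset_univ (active Q S))
      fun i _ _ => ht.2.1 i
    linarith [ht.2.2]
  have hopt := h.optimal d hd
  rw [slotObjective_eq, slotObjective_eq] at hopt
  have e1 : ∑ i, (S i - Q i) * rate p s x i = ∑ i ∈ active Q S, (S i - Q i) * rate p s x i := by
    refine (Finset.sum_subset (Finset.subset_univ _) fun i _ hi => ?_).symm
    simp [rate, (h.silent i hi).1]
  have e2 : ∑ i ∈ p.N₂, (if i ∈ active Q S then (E i - p.θ i) * x.e i else 0)
      = ∑ i ∈ p.N₂, (E i - p.θ i) * x.e i := by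
    refine Finset.sum_congr rfl fun i hi => ?_
    split_ifs with ha
    · rfl
    · rw [(h.silent i ha).2 hi, mul_zero]
  have e3 : ∑ i ∈ active Q S, (S i - Q i) * rate p s d i ≤ ∑ i, (S i - Q i) * m i := by
    refine (Finset.sum_le_sum (g := fun i => (S i - Q i) * m i) fun i hi => ?_).trans
      (Finset.sum_le_sum_of_subset_of_nonneg (Finset.subset_univ _) fun i _ hi => ?_)
    · have : S i < Q i := by simpa [active] using hi
      nlinarith [hm i]
    · have : Q i ≤ S i := by simpa [active] using hi
      exact mul_nonneg (by linarith) (hm i).1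
  -- As `E ≤ θ`, dropping the transmit energies of silent devices can only raise the sum.
  have e4 : ∑ i ∈ p.N₂, (E i - p.θ i) * d.e i
      ≤ ∑ i ∈ p.N₂, (if i ∈ active Q S then (E i - p.θ i) * d.e i else 0) := by
    refine Finset.sum_le_sum fun i hi => ?_
    split_ifs with ha
    · exact le_rfl
    · exact mul_nonpos_of_nonpos_of_nonneg (by linarith [hE i hi]) (hp i hi).1
  simp only [mul_sub (_ - _ : ℝ), Finset.sum_sub_distrib]
  rw [e1]
  linarith

end IsERSDecision

/-! ### Drift of the quadratic Lyapunov function -/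

/-- Half the sum of squares of the backlogs and of the perturbed energies. -/
def lyapunov (p : Params N) (Q S E : Fin N → ℝ) : ℝ :=
  (1 / 2) * (∑ i, (Q i ^ 2 + S i ^ 2) + ∑ i ∈ p.N₂, (E i - p.θ i) ^ 2)

lemma lyapunov_nonneg (p : Params N) (Q S E : Fin N → ℝ) : 0 ≤ lyapunov p Q S E := by
  unfold lyapunov
  positivity

/-- If the queue is emptied, the missing square is `(q - c)²`; otherwise the cross term `-2ac` is
discarded. -/
lemma sq_queue_update_le {q c a C A : ℝ} (hq : 0 ≤ q) (hc : 0 ≤ c) (hcC : c ≤ C) (ha : 0 ≤ a)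
    (haA : a ≤ A) : (max (q - c) 0 + a) ^ 2 ≤ q ^ 2 + C ^ 2 + A ^ 2 + 2 * (q * (a - c)) := by
  have h1 : c ^ 2 ≤ C ^ 2 := by gcongr
  have h2 : a ^ 2 ≤ A ^ 2 := by gcongr
  rcases le_total (q - c) 0 with h | h
  · rw [max_eq_right h]; nlinarith [mul_nonneg hq ha, sq_nonneg (q - c)]
  · rw [max_eq_left h]; nlinarith [mul_nonneg hc ha]

/-- Capping the battery at `θ` moves the energy towards the reference level `θ`, so overflow only
decreases the square. -/
lemma sq_energy_update_le {E θ g e G M : ℝ} (hE : E ≤ θ) (hg : 0 ≤ g) (hgG : g ≤ G) (he : 0 ≤ e)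
    (heM : e ≤ M) : (min (E + g) θ - e - θ) ^ 2
      ≤ (E - θ) ^ 2 + G ^ 2 + M ^ 2 + 2 * ((E - θ) * (g - e)) := by
  have h1 : g ^ 2 ≤ G ^ 2 := by gcongr
  have h2 : e ^ 2 ≤ M ^ 2 := by gcongr
  rcases le_total (E + g) θ with h | h
  · rw [min_eq_left h]; nlinarith [mul_nonneg hg he]
  · rw [min_eq_right h]; nlinarith [mul_nonneg (sub_nonneg.2 hE) he, sq_nonneg (E + g - θ)]

/-- The square `cmax²` enters twice, once as service of `Q` and once as arrival to `S`; this is the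
factor 2 in `B₁`. -/
lemma lyapunov_update_le (p : Params N) {Q S E Q' S' E' : Fin N → ℝ} {s : NSI N} {x : Decision N}
    (hs : ∀ i, 0 ≤ s.h i) (hA : ∀ i, s.A i ≤ p.Amax i)
    (hr : ∀ i, s.r i ∈ Set.Icc 0 (p.rmax i)) (ht : TimeOK x) (hp : PowerOK p x)
    (hx : CollectOK s x) (hc : ∀ i, rate p s x i ≤ p.cmax i)
    (hH : ∀ i, harvest p s x i ≤ p.eHmax i)
    (hQ : ∀ i, 0 ≤ Q i) (hS : ∀ i, 0 ≤ S i) (hE : ∀ i ∈ p.N₂, E i ≤ p.θ i)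
    (hQ' : ∀ i, Q' i = max (Q i - rate p s x i) 0 + x.a i)
    (hS' : ∀ i, S' i = max (S i - s.r i) 0 + min (rate p s x i) (Q i))
    (hE' : ∀ i, E' i = min (E i + harvest p s x i) (p.θ i) - x.e i) :
    lyapunov p Q' S' E' - lyapunov p Q S E ≤ B₁ p
      + (∑ i, (S i - Q i) * rate p s x i
        + ∑ i ∈ p.N₂, (E i - p.θ i) * (harvest p s x i - x.e i)
        + ∑ i, Q i * x.a i - ∑ i, S i * s.r i) := by
  have hrate := rate_nonneg p hs ht hp
  have h1 : ∀ i, Q' i ^ 2 + S' i ^ 2 ≤ (Q i ^ 2 + S i ^ 2)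
      + ((p.Amax i ^ 2 + p.rmax i ^ 2) + 2 * p.cmax i ^ 2)
      + 2 * ((S i - Q i) * rate p s x i + Q i * x.a i - S i * s.r i) := by
    intro i
    have hq := sq_queue_update_le (hQ i) (hrate i) (hc i) (hx i).1 ((hx i).2.trans (hA i))
    have hsq := sq_queue_update_le (hS i) (hr i).1 (hr i).2 (le_min (hrate i) (hQ i))
      ((min_le_left _ _).trans (hc i))
    -- The actual transfer is bounded by the rate, so that the bound has the form which the slot
    -- problem controls.
    have hm : S i * min (rate p s x i) (Q i) ≤ S i * rate p s x i :=
      mul_le_mul_of_nonneg_left (min_le_left _ _) (hS i)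
    rw [hQ', hS']
    nlinarith
  have h2 : ∀ i ∈ p.N₂, (E' i - p.θ i) ^ 2 ≤ (E i - p.θ i) ^ 2
      + (p.eHmax i ^ 2 + (p.Pmax i * p.T) ^ 2)
      + 2 * ((E i - p.θ i) * (harvest p s x i - x.e i)) := by
    intro i hi
    have := sq_energy_update_le (hE i hi) (harvest_nonneg p hs ht i) (hH i) (hp i hi).1
      (energy_le_of_powerOK p ht hp hi)
    rw [hE']
    linarith
  have h3 := Finset.sum_le_sum fun i (_ : i ∈ Finset.univ) => h1 i
  have h4 := Finset.sum_le_sum h2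
  simp only [Finset.sum_add_distrib, Finset.sum_sub_distrib, ← Finset.mul_sum] at h3 h4
  unfold lyapunov B₁
  simp only [Finset.sum_add_distrib]
  linarith


end

/-! ### Tools: transplanting a decision between slots, bounded random variables, sublinear growth.
-/

section

variable {N : ℕ}

/-! ### Comparison with a decision of another slot -/

section Coupling

variable {Ω β γ ι : Type*} [MeasurableSpace Ω] [MeasurableSpace β] [MeasurableSpace γ]
  [StandardBorelSpace γ] [Nonempty γ] [Fintype ι] {P : Measure Ω} [IsProbabilityMeasure P]

/-- If `X` is independent of `Y`, `(Y', Z)` is admissible with `Y'` distributed as `Y`, and `f` is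
at most `∑ k, X k * b k (Y, z)` for every admissible `z`, then the mean of `f` is at most the bound
for independent copies of `X` and `(Y', Z)`. -/
lemma integral_le_of_indepFun {X : ι → Ω → ℝ} {Y Y' : Ω → β} {Z : Ω → γ} {f : Ω → ℝ}
    {b : ι → β × γ → ℝ} {R : Set (β × γ)} (hX : ∀ k, Integrable (X k) P) (hY : Measurable Y)
    (hY' : Measurable Y') (hZ : Measurable Z) (hlaw : P.map Y = P.map Y')
    (hind : ∀ k, IndepFun (X k) Y P) (hR : MeasurableSet R) (hYZ : ∀ᵐ ω ∂P, (Y' ω, Z ω) ∈ R)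
    (hf : Integrable f P) (hb : ∀ k, Measurable (b k))
    (hbi : ∀ k, Integrable (fun ω => b k (Y' ω, Z ω)) P)
    (hle : ∀ᵐ ω ∂P, ∀ z, (Y ω, z) ∈ R → f ω ≤ ∑ k, X k ω * b k (Y ω, z)) :
    ∫ ω, f ω ∂P ≤ ∑ k, (∫ ω, X k ω ∂P) * ∫ ω, b k (Y' ω, Z ω) ∂P := by
  have hpair : Measurable fun ω => (Y' ω, Z ω) := hY'.prodMk hZ
  -- The conditional law of the decision given the state. Evaluated at `Y` it gives a randomized
  -- decision; averaging over `κ` replaces a new random source, so the probability space need not be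
  -- enlarged.
  set κ := condDistrib Z Y' P
  have hκ : P.map Y' ⊗ₘ κ = P.map (fun ω => (Y' ω, Z ω)) :=
    compProd_map_condDistrib hZ.aemeasurable
  have : IsProbabilityMeasure (P.map Y') := Measure.isProbabilityMeasure_map hY'.aemeasurable
  -- Admissibility is a property of the joint law, hence holds `κ y`-almost surely for almost every
  -- `y` under the common law of `Y` and `Y'`.
  have hRκ : ∀ᵐ ω ∂P, ∀ᵐ z ∂κ (Y ω), (Y ω, z) ∈ R := by
    refine ae_of_ae_map (p := fun y => ∀ᵐ z ∂κ y, (y, z) ∈ R) hY.aemeasurable ?_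
    rw [hlaw]
    refine Measure.ae_ae_of_ae_compProd (p := fun q => q ∈ R) ?_
    rw [hκ]
    exact (ae_map_iff (p := fun q => q ∈ R) hpair.aemeasurable hR).2 hYZ
  have hbint : ∀ k, Integrable (b k) (P.map Y' ⊗ₘ κ) := fun k => by
    rw [hκ, integrable_map_measure (hb k).aestronglyMeasurable hpair.aemeasurable]
    exact hbi k
  have hbκ : ∀ k, ∀ᵐ ω ∂P, Integrable (fun z => b k (Y ω, z)) (κ (Y ω)) := fun k => by
    refine ae_of_ae_map (p := fun y => Integrable (fun z => b k (y, z)) (κ y)) hY.aemeasurable ?_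
    rw [hlaw]
    exact ((Measure.integrable_compProd_iff (hb k).aestronglyMeasurable).1 (hbint k)).1
  set B : ι → β → ℝ := fun k y => ∫ z, b k (y, z) ∂κ y
  have hBm : ∀ k, Measurable (B k) := fun k =>
    ((hb k).stronglyMeasurable.integral_kernel_prod_right').measurable
  have hBi : ∀ k, Integrable (B k) (P.map Y') := fun k => (hbint k).integral_compProd
  have hBYi : ∀ k, Integrable (fun ω => B k (Y ω)) P := fun k => by
    have := hBi k
    rw [← hlaw, integrable_map_measure (hBm k).aestronglyMeasurable hY.aemeasurable] at this
    exact this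
  have hBY : ∀ k, ∫ ω, B k (Y ω) ∂P = ∫ ω, b k (Y' ω, Z ω) ∂P := fun k => by
    rw [← integral_map hY.aemeasurable (hBm k).aestronglyMeasurable, hlaw,
      ← Measure.integral_compProd (hbint k), hκ,
      integral_map hpair.aemeasurable (hb k).aestronglyMeasurable]
  -- After integrating out `z` each factor depends on `Y` alone. Every summand is treated
  -- separately, so each `X k` need only be independent of `Y` individually.
  have hindB : ∀ k, IndepFun (X k) (fun ω => B k (Y ω)) P := fun k =>
    (hind k).comp measurable_id (hBm k)
  have hprod : ∀ k, Integrable (fun ω => X k ω * B k (Y ω)) P := fun k =>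
    (hindB k).integrable_mul (hX k) (hBYi k)
  have hmono : ∀ᵐ ω ∂P, f ω ≤ ∑ k, X k ω * B k (Y ω) := by
    filter_upwards [hle, hRκ, ae_all_iff.2 hbκ] with ω h1 h2 h3
    have h4 : ∫ _, f ω ∂κ (Y ω) ≤ ∫ z, ∑ k, X k ω * b k (Y ω, z) ∂κ (Y ω) := by
      refine integral_mono_ae (integrable_const _)
        (integrable_finsetSum _ fun k _ => (h3 k).const_mul _) ?_
      filter_upwards [h2] with z hz using h1 z hz
    rw [integral_finsetSum _ fun k _ => (h3 k).const_mul _] at h4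
    simpa [integral_const_mul] using h4
  calc ∫ ω, f ω ∂P ≤ ∫ ω, ∑ k, X k ω * B k (Y ω) ∂P :=
        integral_mono_ae hf (integrable_finsetSum _ fun k _ => hprod k) hmono
    _ = ∑ k, (∫ ω, X k ω ∂P) * ∫ ω, b k (Y' ω, Z ω) ∂P := by
        rw [integral_finsetSum _ fun k _ => hprod k]
        refine Finset.sum_congr rfl fun k _ => ?_
        rw [(hindB k).integral_fun_mul_eq_mul_integral (hX k).aestronglyMeasurable
          (hBYi k).aestronglyMeasurable, hBY]

end Coupling

/-! ### Measurable, almost surely bounded functions -/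

/-- Measurable and almost surely bounded real functions. -/
def BddMeas {Ω : Type*} [MeasurableSpace Ω] (P : Measure Ω) (f : Ω → ℝ) : Prop :=
  Measurable f ∧ ∃ C, ∀ᵐ ω ∂P, |f ω| ≤ C

namespace BddMeas

variable {Ω : Type*} [MeasurableSpace Ω] {P : Measure Ω} {f g : Ω → ℝ}

lemma integrable [IsFiniteMeasure P] (hf : BddMeas P f) : Integrable f P := by
  obtain ⟨hm, C, hC⟩ := hf
  exact Integrable.of_bound hm.aestronglyMeasurable C hC

lemma of_mem_Icc (hm : Measurable f) {a b : ℝ} (h : ∀ᵐ ω ∂P, a ≤ f ω ∧ f ω ≤ b) :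
    BddMeas P f := by
  refine ⟨hm, max (-a) b, ?_⟩
  filter_upwards [h] with ω hω
  exact abs_le.2 ⟨by linarith [le_max_left (-a) b, hω.1], hω.2.trans (le_max_right _ _)⟩

lemma const (c : ℝ) : BddMeas P fun _ => c := ⟨measurable_const, |c|, by simp⟩

lemma add (hf : BddMeas P f) (hg : BddMeas P g) : BddMeas P fun ω => f ω + g ω := by
  obtain ⟨hm, C, hC⟩ := hf
  obtain ⟨hm', D, hD⟩ := hg
  refine ⟨hm.add hm', C + D, ?_⟩
  filter_upwards [hC, hD] with ω h1 h2
  exact (abs_add_le _ _).trans (add_le_add h1 h2)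

lemma neg (hf : BddMeas P f) : BddMeas P fun ω => -f ω := by
  obtain ⟨hm, C, hC⟩ := hf
  exact ⟨hm.neg, C, by simpa using hC⟩

lemma sub (hf : BddMeas P f) (hg : BddMeas P g) : BddMeas P fun ω => f ω - g ω := by
  simpa [sub_eq_add_neg] using hf.add hg.neg

lemma mul (hf : BddMeas P f) (hg : BddMeas P g) : BddMeas P fun ω => f ω * g ω := by
  obtain ⟨hm, C, hC⟩ := hf
  obtain ⟨hm', D, hD⟩ := hg
  refine ⟨hm.mul hm', C * D, ?_⟩
  filter_upwards [hC, hD] with ω h1 h2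
  rw [abs_mul]
  exact mul_le_mul h1 h2 (abs_nonneg _) ((abs_nonneg _).trans h1)

lemma max (hf : BddMeas P f) (hg : BddMeas P g) : BddMeas P fun ω => max (f ω) (g ω) := by
  obtain ⟨hm, C, hC⟩ := hf
  obtain ⟨hm', D, hD⟩ := hg
  refine ⟨hm.max hm', Max.max C D, ?_⟩
  filter_upwards [hC, hD] with ω h1 h2
  exact abs_max_le_max_abs_abs.trans (max_le_max h1 h2)

lemma min (hf : BddMeas P f) (hg : BddMeas P g) : BddMeas P fun ω => min (f ω) (g ω) := by
  obtain ⟨hm, C, hC⟩ := hf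
  obtain ⟨hm', D, hD⟩ := hg
  refine ⟨hm.min hm', Max.max C D, ?_⟩
  filter_upwards [hC, hD] with ω h1 h2
  exact abs_min_le_max_abs_abs.trans (max_le_max h1 h2)

lemma sum {ι : Type*} {t : Finset ι} {f : ι → Ω → ℝ} (hf : ∀ i ∈ t, BddMeas P (f i)) :
    BddMeas P fun ω => ∑ i ∈ t, f i ω := by
  classical
  induction t using Finset.induction_on with
  | empty => simpa using const (P := P) 0
  | insert a t ha ih =>
    simp only [Finset.sum_insert ha]
    exact (hf a (Finset.mem_insert_self a t)).add
      (ih fun i hi => hf i (Finset.mem_insert_of_mem hi))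

end BddMeas

/-! ### Mean rate stability -/

/-- A nonnegative sequence with bounded downward steps and bounded averages grows sublinearly. -/
lemma tendsto_div_of_average_le {q : ℕ → ℝ} {C M : ℝ} (hq : ∀ t, 0 ≤ q t)
    (hstep : ∀ t, q t - C ≤ q (t + 1))
    (havg : ∀ᶠ t : ℕ in atTop, ∑ τ ∈ Finset.range t, q τ ≤ M * t) :
    Tendsto (fun t : ℕ => q t / t) atTop (nhds 0) := by
  wlog hC : 0 ≤ C generalizing C
  · exact this (C := 0) (fun t => by linarith [hstep t, not_le.1 hC]) le_rfl
  have hshift : ∀ t j : ℕ, q t - j * C ≤ q (t + j) := by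
    intro t j
    induction j with
    | zero => simp
    | succ j ih =>
      have := hstep (t + j)
      rw [← add_assoc]
      push_cast
      linarith
  -- A large value at `t` persists over the next `k` slots up to a loss of `k C`, and so contributes
  -- to the running sum.
  have hkey : ∀ t k : ℕ, k * q t - k * (k * C) ≤ ∑ τ ∈ Finset.range (t + k), q τ := by
    intro t k
    rw [Finset.sum_range_add]
    have h1 : 0 ≤ ∑ τ ∈ Finset.range t, q τ := Finset.sum_nonneg fun _ _ => hq _
    have h2 : ∑ j ∈ Finset.range k, (q t - k * C) ≤ ∑ j ∈ Finset.range k, q (t + j) := by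
      refine Finset.sum_le_sum fun j hj => (le_trans ?_ (hshift t j))
      have : (j : ℝ) ≤ k := by exact_mod_cast (Finset.mem_range.1 hj).le
      nlinarith
    simp only [Finset.sum_const, Finset.card_range, nsmul_eq_mul] at h2
    linarith
  -- The window `k = √t` balances the errors: dividing by `k t` leaves `M/k + M/t + kC/t`, which
  -- tends to zero as `k → ∞` and `k/t → 0`.
  have hlim : Tendsto (fun t : ℕ => M / ((t.sqrt : ℕ) : ℝ) + M / t + (t.sqrt : ℝ) / t * C)
      atTop (nhds 0) := by
    have hs : Tendsto (fun t : ℕ => ((t.sqrt : ℕ) : ℝ)) atTop atTop := by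
      refine tendsto_natCast_atTop_atTop.comp (tendsto_atTop.2 fun b => ?_)
      filter_upwards [eventually_ge_atTop (b * b)] with t ht using Nat.le_sqrt.2 ht
    have h1 := hs.const_div_atTop M
    have h2 := tendsto_const_div_atTop_nhds_zero_nat M
    have h3 : Tendsto (fun t : ℕ => (t.sqrt : ℝ) / t) atTop (nhds 0) := by
      refine tendsto_of_tendsto_of_tendsto_of_le_of_le' tendsto_const_nhds
        (hs.const_div_atTop 1) (Eventually.of_forall fun t => by positivity) ?_
      filter_upwards [eventually_ge_atTop 1] with t ht
      have h4 : 0 < t.sqrt := Nat.sqrt_pos.2 ht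
      rw [div_le_div_iff₀ (by exact_mod_cast ht) (by exact_mod_cast h4), one_mul]
      exact_mod_cast Nat.sqrt_le t
    simpa using (h1.add h2).add (h3.mul_const C)
  refine tendsto_of_tendsto_of_tendsto_of_le_of_le' tendsto_const_nhds hlim
    (Eventually.of_forall fun t => div_nonneg (hq t) t.cast_nonneg) ?_
  obtain ⟨t₀, ht₀⟩ := eventually_atTop.1 havg
  filter_upwards [eventually_ge_atTop (max t₀ 1)] with t ht
  have ht1 : 1 ≤ t := (le_max_right _ _).trans ht
  have hk : 0 < t.sqrt := Nat.sqrt_pos.2 ht1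
  have h := (hkey t t.sqrt).trans (ht₀ (t + t.sqrt) (((le_max_left _ _).trans ht).trans
    (Nat.le_add_right _ _)))
  push_cast at h
  have htr : (0 : ℝ) < t := by exact_mod_cast ht1
  have hkr : (0 : ℝ) < t.sqrt := by exact_mod_cast hk
  rw [div_le_iff₀ htr]
  have h5 : (M / (t.sqrt : ℝ) + M / t + (t.sqrt : ℝ) / t * C) * t
      = (M * (t + t.sqrt) + t.sqrt * (t.sqrt * C)) / t.sqrt := by
    field_simp
  rw [h5, le_div_iff₀ hkr]
  linarith

/-- Passes from extended nonnegative averages to real ones: a finite upper limit is eventually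
dominated by a finite constant. -/
lemma StronglyStable.exists_average_le {Ω : Type*} [MeasurableSpace Ω] {P : Measure Ω}
    {X : ℕ → Ω → ℝ} (h : StronglyStable P X) (hX : ∀ t, 0 ≤ᵐ[P] X t)
    (hi : ∀ t, Integrable (X t) P) :
    ∃ M : ℝ, ∀ᶠ t : ℕ in atTop, ∑ τ ∈ Finset.range t, ∫ ω, X τ ω ∂P ≤ M * t := by
  obtain ⟨M, hM, hMtop⟩ := exists_between h
  refine ⟨M.toReal, ?_⟩
  filter_upwards [eventually_lt_of_limsup_lt hM, eventually_ge_atTop 1] with t ht ht1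
  have hconv : ∑ τ ∈ Finset.range t, ∫⁻ ω, ENNReal.ofReal (X τ ω) ∂P
      = ENNReal.ofReal (∑ τ ∈ Finset.range t, ∫ ω, X τ ω ∂P) := by
    rw [ENNReal.ofReal_sum_of_nonneg fun τ _ => integral_nonneg_of_ae (hX τ)]
    exact Finset.sum_congr rfl fun τ _ =>
      (ofReal_integral_eq_lintegral_ofReal (hi τ) (hX τ)).symm
  rw [hconv, ENNReal.div_lt_iff (Or.inl (by positivity)) (Or.inl (ENNReal.natCast_ne_top t))] at ht
  have := (ENNReal.ofReal_le_iff_le_toReal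
    (ENNReal.mul_ne_top hMtop.ne (ENNReal.natCast_ne_top t))).1 ht.le
  simpa using this


end

/-! ### Backlogs and energies as random variables; long-run balances of admissible processes. -/

section

variable {N : ℕ}

/-! ### Measurability -/

lemma NSI.measurable_h (i : Fin N) : Measurable fun q : NSI N => q.h i := by
  unfold NSI.h; fun_prop

lemma NSI.measurable_A (i : Fin N) : Measurable fun q : NSI N => q.A i := by
  unfold NSI.A; fun_prop

lemma NSI.measurable_r (i : Fin N) : Measurable fun q : NSI N => q.r i := by
  unfold NSI.r; fun_prop

lemma Decision.measurable_μ₀ : Measurable fun q : Decision N => q.μ₀ := by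
  unfold Decision.μ₀; fun_prop

lemma Decision.measurable_μ (i : Fin N) : Measurable fun q : Decision N => q.μ i := by
  unfold Decision.μ; fun_prop

lemma Decision.measurable_e (i : Fin N) : Measurable fun q : Decision N => q.e i := by
  unfold Decision.e; fun_prop

lemma Decision.measurable_a (i : Fin N) : Measurable fun q : Decision N => q.a i := by
  unfold Decision.a; fun_prop

lemma measurable_harvest (p : Params N) (i : Fin N) :
    Measurable fun q : NSI N × Decision N => harvest p q.1 q.2 i := by
  have h1 : Measurable fun q : NSI N × Decision N => q.1.h i :=
    (NSI.measurable_h i).comp measurable_fst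
  have h2 : Measurable fun q : NSI N × Decision N => q.2.μ₀ :=
    Decision.measurable_μ₀.comp measurable_snd
  exact ((h1.const_mul (p.ξ i * p.P₀)).mul h2).mul_const p.T

lemma measurable_rate (p : Params N) (i : Fin N) :
    Measurable fun q : NSI N × Decision N => rate p q.1 q.2 i := by
  have h1 : Measurable fun q : NSI N × Decision N => q.1.h i :=
    (NSI.measurable_h i).comp measurable_fst
  have h2 : Measurable fun q : NSI N × Decision N => q.2.μ i :=
    (Decision.measurable_μ i).comp measurable_snd
  have h3 : Measurable fun q : NSI N × Decision N => q.2.e i :=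
    (Decision.measurable_e i).comp measurable_snd
  have h4 : Measurable fun q : NSI N × Decision N => txPower p q.1 q.2 i := by
    unfold txPower
    refine Measurable.ite (h2 (measurableSet_singleton 0)) measurable_const ?_
    split_ifs
    · exact h3.div (h2.mul_const p.T)
    · exact (measurable_harvest p i).div (h2.mul_const p.T)
  have h5 : Measurable fun q : NSI N × Decision N =>
      Real.logb 2 (1 + txPower p q.1 q.2 i * q.1.h i / p.N₀) := by
    unfold Real.logb
    exact (Real.measurable_log.comp (((h4.mul h1).div_const p.N₀).const_add 1)).div_const _
  exact ((h2.mul_const p.T).mul_const p.W).mul h5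

/-! ### Backlogs and energies as random variables -/

section Path

variable {Ω : Type*}

/-- Data backlog of device `i` at slot `t` as a random variable. -/
def pathQ (p : Params N) (s : ℕ → Ω → NSI N) (x : ℕ → Ω → Decision N) (t : ℕ) (i : Fin N)
    (ω : Ω) : ℝ := queueQ p (fun τ => s τ ω) (fun τ => x τ ω) t i

/-- Data backlog of the access point for device `i` at slot `t` as a random variable. -/
def pathS (p : Params N) (s : ℕ → Ω → NSI N) (x : ℕ → Ω → Decision N) (t : ℕ) (i : Fin N)
    (ω : Ω) : ℝ := queueS p (fun τ => s τ ω) (fun τ => x τ ω) t i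

/-- Energy of device `i` at slot `t` as a random variable. -/
def pathE (p : Params N) (s : ℕ → Ω → NSI N) (x : ℕ → Ω → Decision N) (t : ℕ) (i : Fin N)
    (ω : Ω) : ℝ := energyE p (fun τ => s τ ω) (fun τ => x τ ω) t i

variable (p : Params N) (s : ℕ → Ω → NSI N) (x : ℕ → Ω → Decision N)

lemma pathQ_succ (t : ℕ) (i : Fin N) (ω : Ω) : pathQ p s x (t + 1) i ω
    = max (pathQ p s x t i ω - rate p (s t ω) (x t ω) i) 0 + (x t ω).a i := rfl

lemma pathS_succ (t : ℕ) (i : Fin N) (ω : Ω) : pathS p s x (t + 1) i ω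
    = max (pathS p s x t i ω - (s t ω).r i) 0
      + min (rate p (s t ω) (x t ω) i) (pathQ p s x t i ω) := rfl

lemma pathE_succ (t : ℕ) (i : Fin N) (ω : Ω) : pathE p s x (t + 1) i ω
    = min (pathE p s x t i ω + harvest p (s t ω) (x t ω) i) (p.θ i) - (x t ω).e i := rfl

variable {s x} [MeasurableSpace Ω]

lemma measurable_pathQ {t : ℕ} (hs : ∀ τ < t, Measurable (s τ)) (hx : ∀ τ < t, Measurable (x τ))
    (i : Fin N) : Measurable (pathQ p s x t i) := by
  induction t with
  | zero => exact measurable_const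
  | succ t ih =>
    have h1 := hs t t.lt_succ_self
    have h2 := hx t t.lt_succ_self
    have h3 := ih (fun τ hτ => hs τ (hτ.trans t.lt_succ_self))
      (fun τ hτ => hx τ (hτ.trans t.lt_succ_self))
    exact ((h3.sub ((measurable_rate p i).comp (h1.prodMk h2))).max measurable_const).add
      ((Decision.measurable_a i).comp h2)

lemma measurable_pathS {t : ℕ} (hs : ∀ τ < t, Measurable (s τ)) (hx : ∀ τ < t, Measurable (x τ))
    (i : Fin N) : Measurable (pathS p s x t i) := by
  induction t with
  | zero => exact measurable_const
  | succ t ih =>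
    have h1 := hs t t.lt_succ_self
    have h2 := hx t t.lt_succ_self
    have hs' := fun τ (hτ : τ < t) => hs τ (hτ.trans t.lt_succ_self)
    have hx' := fun τ (hτ : τ < t) => hx τ (hτ.trans t.lt_succ_self)
    exact (((ih hs' hx').sub ((NSI.measurable_r i).comp h1)).max measurable_const).add
      (((measurable_rate p i).comp (h1.prodMk h2)).min (measurable_pathQ p hs' hx' i))

lemma measurable_pathE {t : ℕ} (hs : ∀ τ < t, Measurable (s τ)) (hx : ∀ τ < t, Measurable (x τ))
    (i : Fin N) : Measurable (pathE p s x t i) := by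
  induction t with
  | zero => exact measurable_const
  | succ t ih =>
    have h1 := hs t t.lt_succ_self
    have h2 := hx t t.lt_succ_self
    have h3 := ih (fun τ hτ => hs τ (hτ.trans t.lt_succ_self))
      (fun τ hτ => hx τ (hτ.trans t.lt_succ_self))
    exact ((h3.add ((measurable_harvest p i).comp (h1.prodMk h2))).min measurable_const).sub
      ((Decision.measurable_e i).comp h2)

end Path

/-! ### Admissible decision processes -/

/-- Decision processes that obey the time, power and collection constraints. -/
structure Admissible {Ω : Type*} [MeasurableSpace Ω] (P : Measure Ω) (p : Params N)
    (s : ℕ → Ω → NSI N) (x : ℕ → Ω → Decision N) : Prop where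
  meas : ∀ t, Measurable (x t)
  time : ∀ t, ∀ᵐ ω ∂P, TimeOK (x t ω)
  power : ∀ t, ∀ᵐ ω ∂P, PowerOK p (x t ω)
  collect : ∀ t, ∀ᵐ ω ∂P, CollectOK (s t ω) (x t ω)

variable {Ω : Type*} [MeasurableSpace Ω] {P : Measure Ω} {p : Params N}
  {s : ℕ → Ω → NSI N} {x : ℕ → Ω → Decision N}

lemma OfflineFeasible.admissible (hx : OfflineFeasible P p s x) : Admissible P p s x :=
  ⟨hx.meas, hx.time, hx.power, hx.collect⟩

lemma IsNetwork.bddMeas_r (hs : IsNetwork P p s) (t : ℕ) (i : Fin N) :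
    BddMeas P fun ω => (s t ω).r i :=
  .of_mem_Icc ((NSI.measurable_r i).comp (hs.meas t)) ((hs.r_mem t).mono fun _ h => h i)

namespace Admissible

variable (hx : Admissible P p s x) (hs : IsNetwork P p s)
include hx hs

lemma bddMeas_rate (t : ℕ) (i : Fin N) : BddMeas P fun ω => rate p (s t ω) (x t ω) i := by
  refine .of_mem_Icc (a := 0) (b := p.cmax i)
    ((measurable_rate p i).comp ((hs.meas t).prodMk (hx.meas t))) ?_
  filter_upwards [hs.h_nonneg t, hs.rate_le t, hx.time t, hx.power t] with ω h1 h2 h3 h4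
  exact ⟨rate_nonneg p h1 h3 h4 i, h2 _ h3 h4 i⟩

lemma bddMeas_harvest (t : ℕ) (i : Fin N) : BddMeas P fun ω => harvest p (s t ω) (x t ω) i := by
  refine .of_mem_Icc (a := 0) (b := p.eHmax i)
    ((measurable_harvest p i).comp ((hs.meas t).prodMk (hx.meas t))) ?_
  filter_upwards [hs.h_nonneg t, hs.harvest_le t, hx.time t] with ω h1 h2 h3
  exact ⟨harvest_nonneg p h1 h3 i, h2 _ h3 i⟩

lemma bddMeas_a (t : ℕ) (i : Fin N) : BddMeas P fun ω => (x t ω).a i := by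
  refine .of_mem_Icc (a := 0) (b := p.Amax i) ((Decision.measurable_a i).comp (hx.meas t)) ?_
  filter_upwards [hs.A_mem t, hx.collect t] with ω h1 h2
  exact ⟨(h2 i).1, (h2 i).2.trans (h1 i).2⟩

lemma log_mem (t : ℕ) (i : Fin N) :
    ∀ᵐ ω ∂P, 0 ≤ Real.log (1 + (x t ω).a i) ∧ Real.log (1 + (x t ω).a i) ≤ p.Amax i := by
  filter_upwards [hs.A_mem t, hx.collect t] with ω h1 h2
  have h3 := (h2 i).1
  refine ⟨Real.log_nonneg (by linarith), ?_⟩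
  have := Real.log_le_sub_one_of_pos (x := 1 + (x t ω).a i) (by linarith)
  linarith [(h2 i).2, (h1 i).2]

lemma bddMeas_log (t : ℕ) (i : Fin N) : BddMeas P fun ω => Real.log (1 + (x t ω).a i) :=
  .of_mem_Icc (Real.measurable_log.comp
    (((Decision.measurable_a i).comp (hx.meas t)).const_add 1)) (hx.log_mem hs t i)

omit hs in
lemma bddMeas_e (t : ℕ) {i : Fin N} (hi : i ∈ p.N₂) : BddMeas P fun ω => (x t ω).e i := by
  refine .of_mem_Icc (a := 0) (b := p.Pmax i * p.T) ((Decision.measurable_e i).comp (hx.meas t)) ?_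
  filter_upwards [hx.time t, hx.power t] with ω h1 h2
  exact ⟨(h2 i hi).1, energy_le_of_powerOK p h1 h2 hi⟩

/-- The bound may depend on `t`; it serves integrability in each slot and says nothing about
stability. -/
lemma bddMeas_pathQ (t : ℕ) (i : Fin N) : BddMeas P (pathQ p s x t i) := by
  induction t with
  | zero => exact .const _
  | succ t ih => exact ((ih.sub (hx.bddMeas_rate hs t i)).max (.const 0)).add (hx.bddMeas_a hs t i)

lemma bddMeas_min (t : ℕ) (i : Fin N) :
    BddMeas P fun ω => min (rate p (s t ω) (x t ω) i) (pathQ p s x t i ω) :=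
  (hx.bddMeas_rate hs t i).min (hx.bddMeas_pathQ hs t i)

lemma bddMeas_pathS (t : ℕ) (i : Fin N) : BddMeas P (pathS p s x t i) := by
  induction t with
  | zero => exact .const _
  | succ t ih =>
    exact ((ih.sub (hs.bddMeas_r t i)).max (.const 0)).add
      ((hx.bddMeas_rate hs t i).min (hx.bddMeas_pathQ hs t i))

lemma bddMeas_pathE (t : ℕ) {i : Fin N} (hi : i ∈ p.N₂) : BddMeas P (pathE p s x t i) := by
  induction t with
  | zero => exact .const _
  | succ t ih => exact ((ih.add (hx.bddMeas_harvest hs t i)).min (.const _)).sub (hx.bddMeas_e t hi)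

omit hs in
lemma pathQ_nonneg (t : ℕ) : ∀ᵐ ω ∂P, ∀ i, 0 ≤ pathQ p s x t i ω := by
  cases t with
  | zero => exact .of_forall fun _ i => p.Q₀_nonneg i
  | succ t =>
    filter_upwards [hx.collect t] with ω h i
    exact add_nonneg (le_max_right _ _) (h i).1

lemma pathS_nonneg (t : ℕ) : ∀ᵐ ω ∂P, ∀ i, 0 ≤ pathS p s x t i ω := by
  cases t with
  | zero => exact .of_forall fun _ i => p.S₀_nonneg i
  | succ t =>
    filter_upwards [hx.pathQ_nonneg t, hs.h_nonneg t, hx.time t, hx.power t] with ω h1 h2 h3 h4 i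
    exact add_nonneg (le_max_right _ _) (le_min (rate_nonneg p h2 h3 h4 i) (h1 i))

omit hs in
lemma pathE_le (t : ℕ) : ∀ᵐ ω ∂P, ∀ i ∈ p.N₂, pathE p s x t i ω ≤ p.θ i := by
  cases t with
  | zero => exact .of_forall fun _ i hi => (p.E₀_mem i hi).2
  | succ t =>
    filter_upwards [hx.power t] with ω h i hi
    rw [pathE_succ]
    linarith [min_le_right (pathE p s x t i ω + harvest p (s t ω) (x t ω) i) (p.θ i), (h i hi).1]

end Admissible

/-! ### Long-run averages of feasible offline processes -/

namespace Admissible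

variable [IsProbabilityMeasure P] (hx : Admissible P p s x) (hs : IsNetwork P p s)
include hx hs

/-- Since `max (Q - c) 0 = Q - min c Q`, the increment of the backlog is exactly arrival minus
actual departure, and the sum telescopes. -/
lemma sum_integral_arrival_sub_departure (t : ℕ) (i : Fin N) :
    ∑ τ ∈ Finset.range t, ∫ ω, ((x τ ω).a i
      - min (rate p (s τ ω) (x τ ω) i) (pathQ p s x τ i ω)) ∂P
      = ∫ ω, pathQ p s x t i ω ∂P - p.Q₀ i := by
  have h0 : p.Q₀ i = ∫ ω, pathQ p s x 0 i ω ∂P := by simp [pathQ, queueQ]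
  rw [h0, ← Finset.sum_range_sub (fun t => ∫ ω, pathQ p s x t i ω ∂P)]
  refine Finset.sum_congr rfl fun τ _ => ?_
  rw [← integral_sub (hx.bddMeas_pathQ hs _ i).integrable (hx.bddMeas_pathQ hs _ i).integrable]
  refine integral_congr_ae (.of_forall fun ω => ?_)
  simp only [pathQ_succ]
  rcases le_total (rate p (s τ ω) (x τ ω) i) (pathQ p s x τ i ω) with h | h
  · rw [min_eq_left h, max_eq_left (by linarith)]; ring
  · rw [min_eq_right h, max_eq_right (by linarith)]; ring

lemma sum_integral_departure_sub_processed (t : ℕ) (i : Fin N) :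
    ∑ τ ∈ Finset.range t, ∫ ω, (min (rate p (s τ ω) (x τ ω) i) (pathQ p s x τ i ω)
      - (s τ ω).r i) ∂P ≤ ∫ ω, pathS p s x t i ω ∂P := by
  have h0 : p.S₀ i = ∫ ω, pathS p s x 0 i ω ∂P := by simp [pathS, queueS]
  refine le_trans ?_ (sub_le_self _ (p.S₀_nonneg i))
  rw [h0, ← Finset.sum_range_sub (fun t => ∫ ω, pathS p s x t i ω ∂P)]
  refine Finset.sum_le_sum fun τ _ => ?_
  rw [← integral_sub (hx.bddMeas_pathS hs _ i).integrable (hx.bddMeas_pathS hs _ i).integrable]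
  refine integral_mono ((hx.bddMeas_min hs τ i).sub (hs.bddMeas_r τ i)).integrable
    ((hx.bddMeas_pathS hs _ i).sub (hx.bddMeas_pathS hs _ i)).integrable fun ω => ?_
  simp only [pathS_succ]
  linarith [le_max_left (pathS p s x τ i ω - (s τ ω).r i) 0]

/-- Overflow can only waste energy. This direction is the useful one, because the energy weights `E
- θ` are nonpositive. -/
lemma integral_pathE_sub_le (t : ℕ) {i : Fin N} (hi : i ∈ p.N₂) :
    ∫ ω, pathE p s x t i ω ∂P - p.E₀ i
      ≤ ∑ τ ∈ Finset.range t, ∫ ω, (harvest p (s τ ω) (x τ ω) i - (x τ ω).e i) ∂P := by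
  have h0 : p.E₀ i = ∫ ω, pathE p s x 0 i ω ∂P := by simp [pathE, energyE]
  rw [h0, ← Finset.sum_range_sub (fun t => ∫ ω, pathE p s x t i ω ∂P)]
  refine Finset.sum_le_sum fun τ _ => ?_
  rw [← integral_sub (hx.bddMeas_pathE hs _ hi).integrable (hx.bddMeas_pathE hs _ hi).integrable]
  refine integral_mono ((hx.bddMeas_pathE hs _ hi).sub (hx.bddMeas_pathE hs _ hi)).integrable
    ((hx.bddMeas_harvest hs τ i).sub (hx.bddMeas_e τ hi)).integrable fun ω => ?_
  simp only [pathE_succ]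
  linarith [min_le_left (pathE p s x τ i ω + harvest p (s τ ω) (x τ ω) i) (p.θ i)]

/-- In one slot the backlog drops by at most `cmax`, so bounded averages exclude linear growth. -/
lemma tendsto_integral_pathQ_div (i : Fin N) (h : StronglyStable P fun t ω => pathQ p s x t i ω) :
    Tendsto (fun t : ℕ => (∫ ω, pathQ p s x t i ω ∂P) / t) atTop (nhds 0) := by
  have h0 : ∀ t, 0 ≤ᵐ[P] pathQ p s x t i := fun t => (hx.pathQ_nonneg t).mono fun ω h => h i
  obtain ⟨M, hM⟩ := h.exists_average_le h0 fun t => (hx.bddMeas_pathQ hs t i).integrable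
  refine tendsto_div_of_average_le (C := p.cmax i) (fun t => integral_nonneg_of_ae (h0 t))
    (fun t => ?_) hM
  have hc : ∫ _, p.cmax i ∂P = p.cmax i := by simp
  rw [← hc, ← integral_sub (hx.bddMeas_pathQ hs t i).integrable (integrable_const _)]
  refine integral_mono_ae ((hx.bddMeas_pathQ hs t i).integrable.sub (integrable_const _))
    (hx.bddMeas_pathQ hs _ i).integrable ?_
  filter_upwards [hs.rate_le t, hx.time t, hx.power t, hx.collect t] with ω h1 h2 h3 h4
  rw [pathQ_succ]
  linarith [le_max_left (pathQ p s x t i ω - rate p (s t ω) (x t ω) i) 0, h1 _ h2 h3 i, (h4 i).1]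

lemma tendsto_integral_pathS_div (i : Fin N) (h : StronglyStable P fun t ω => pathS p s x t i ω) :
    Tendsto (fun t : ℕ => (∫ ω, pathS p s x t i ω ∂P) / t) atTop (nhds 0) := by
  have h0 : ∀ t, 0 ≤ᵐ[P] pathS p s x t i := fun t => (hx.pathS_nonneg hs t).mono fun ω h => h i
  obtain ⟨M, hM⟩ := h.exists_average_le h0 fun t => (hx.bddMeas_pathS hs t i).integrable
  refine tendsto_div_of_average_le (C := p.rmax i) (fun t => integral_nonneg_of_ae (h0 t))
    (fun t => ?_) hM
  have hc : ∫ _, p.rmax i ∂P = p.rmax i := by simp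
  rw [← hc, ← integral_sub (hx.bddMeas_pathS hs t i).integrable (integrable_const _)]
  refine integral_mono_ae ((hx.bddMeas_pathS hs t i).integrable.sub (integrable_const _))
    (hx.bddMeas_pathS hs _ i).integrable ?_
  filter_upwards [hs.r_mem t, hs.h_nonneg t, hx.time t, hx.power t, hx.pathQ_nonneg t]
    with ω h1 h2 h3 h4 h5
  rw [pathS_succ]
  linarith [le_max_left (pathS p s x t i ω - (s t ω).r i) 0, (h1 i).2,
    le_min (rate_nonneg p h2 h3 h4 i) (h5 i)]

end Admissible

/-- The energy may become negative: availability is tested before the cap, and the cap at `θ` may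
then fall below the energy spent. The deficit never exceeds the largest energy spent in one slot. -/
lemma OfflineFeasible.pathE_ge (hx : OfflineFeasible P p s x) (t : ℕ) :
    ∀ᵐ ω ∂P, ∀ i ∈ p.N₂, -(p.Pmax i * p.T) ≤ pathE p s x t i ω := by
  cases t with
  | zero =>
    refine .of_forall fun _ i hi => ?_
    have := mul_pos (p.Pmax_pos i hi) p.T_pos
    exact (neg_nonpos.2 this.le).trans (p.E₀_mem i hi).1
  | succ t =>
    filter_upwards [hx.time t, hx.power t, hx.energy t] with ω h1 h2 h3 i hi
    have h4 := h3 i hi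
    have h5 := energy_le_of_powerOK p h1 h2 hi
    have h6 := mul_pos (p.Pmax_pos i hi) p.T_pos
    have h7 := p.θ_pos i hi
    rw [pathE_succ]
    rcases min_choice (pathE p s x t i ω + harvest p (s t ω) (x t ω) i) (p.θ i) with h | h <;>
      rw [h]
    · have : (x t ω).e i ≤ pathE p s x t i ω + harvest p (s t ω) (x t ω) i := h4
      linarith
    · linarith


end

/-! ### Drift-plus-penalty comparison with the offline optimum. -/

section

variable {N : ℕ}

/-! ### Per-slot comparison of the algorithm with offline processes -/

/-- Weighted cost of a decision that bounds the Lyapunov drift minus `V` times the utility. -/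
def slotCost (p : Params N) (Q S E : Fin N → ℝ) (s : NSI N) (x : Decision N) : ℝ :=
  ∑ i, (S i - Q i) * rate p s x i + ∑ i ∈ p.N₂, (E i - p.θ i) * (harvest p s x i - x.e i)
    + ∑ i, Q i * x.a i - ∑ i, S i * s.r i - p.V * ∑ i, Real.log (1 + x.a i)

/-- Pairs of a state and an admissible decision together with amounts of offloaded data that do not
exceed the achievable ones. -/
def admissibleSet (p : Params N) : Set (NSI N × (Decision N × (Fin N → ℝ))) :=
  {q | TimeOK q.2.1 ∧ PowerOK p q.2.1 ∧ CollectOK q.1 q.2.1 ∧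
    ∀ i, 0 ≤ q.2.2 i ∧ q.2.2 i ≤ rate p q.1 q.2.1 i}

lemma measurableSet_admissibleSet (p : Params N) : MeasurableSet (admissibleSet p) := by
  have hle : ∀ {f g : NSI N × (Decision N × (Fin N → ℝ)) → ℝ}, Measurable f → Measurable g →
      Measurable fun q => f q ≤ g q := fun hf hg => measurableSet_setOfPred.1 (measurableSet_le hf hg)
  have hd : Measurable fun q : NSI N × (Decision N × (Fin N → ℝ)) => q.2.1 :=
    measurable_fst.comp measurable_snd
  have hμ₀ := Decision.measurable_μ₀.comp hd
  have hμ := fun i => (Decision.measurable_μ i).comp hd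
  have he := fun i => (Decision.measurable_e i).comp hd
  have ha := fun i => (Decision.measurable_a i).comp hd
  have hA : ∀ i, Measurable fun q : NSI N × (Decision N × (Fin N → ℝ)) => q.1.A i :=
    fun i => (NSI.measurable_A i).comp measurable_fst
  have hm : ∀ i, Measurable fun q : NSI N × (Decision N × (Fin N → ℝ)) => q.2.2 i := fun i => by
    fun_prop
  have hr : ∀ i, Measurable fun q : NSI N × (Decision N × (Fin N → ℝ)) => rate p q.1 q.2.1 i :=
    fun i => (measurable_rate p i).comp (measurable_fst.prodMk hd)
  refine measurableSet_setOfPred.2 (Measurable.and ?_ (Measurable.and ?_ (Measurable.and ?_ ?_)))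
  · exact (hle measurable_const hμ₀).and ((Measurable.forall fun i => hle measurable_const (hμ i)).and
      (hle (hμ₀.add (Finset.measurable_sum _ fun i _ => hμ i)) measurable_const))
  · exact Measurable.forall fun i => measurable_const.imp ((hle measurable_const (he i)).and
      (hle (he i) (((hμ i).const_mul _).mul_const _)))
  · exact Measurable.forall fun i => (hle measurable_const (ha i)).and (hle (ha i) (hA i))
  · exact Measurable.forall fun i => (hle measurable_const (hm i)).and (hle (hm i) (hr i))

/-- The right side is regrouped as backlogs times increments of the compared process, the form that
factorizes under independence and telescopes over slots. -/
lemma IsERSDecision.slotCost_le {p : Params N} {Q S E : Fin N → ℝ} {s : NSI N} {x : Decision N}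
    (h : IsERSDecision p Q S E s x) (hQ : ∀ i, 0 ≤ Q i)
    (hE : ∀ i ∈ p.N₂, E i ≤ p.θ i) (hA : ∀ i, 0 ≤ s.A i)
    {d : Decision N} {m : Fin N → ℝ} (hd : (s, d, m) ∈ admissibleSet p) :
    slotCost p Q S E s x ≤ ∑ i, Q i * (d.a i - m i) + ∑ i, S i * (m i - s.r i)
      + ∑ i ∈ p.N₂, (E i - p.θ i) * (harvest p s d i - d.e i)
      + -p.V * ∑ i, Real.log (1 + d.a i) := by
  obtain ⟨ht, hp, hc, hm⟩ := hd
  have h1 := h.weighted_sum_le hE ht hp hm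
  have h2 := Finset.sum_le_sum fun i (_ : i ∈ Finset.univ) =>
    h.collect_optimal hQ hA i (hc i).1 (hc i).2
  simp only [Finset.sum_sub_distrib, ← Finset.mul_sum] at h2
  have h3 : ∑ i, (S i - Q i) * m i = ∑ i, S i * m i - ∑ i, Q i * m i := by
    simp only [sub_mul, Finset.sum_sub_distrib]
  have h4 : ∑ i, Q i * (d.a i - m i) = ∑ i, Q i * d.a i - ∑ i, Q i * m i := by
    simp only [mul_sub, Finset.sum_sub_distrib]
  have h5 : ∑ i, S i * (m i - s.r i) = ∑ i, S i * m i - ∑ i, S i * s.r i := by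
    simp only [mul_sub, Finset.sum_sub_distrib]
  unfold slotCost
  linarith

variable {Ω : Type*} [MeasurableSpace Ω] {P : Measure Ω} {p : Params N}
  {s : ℕ → Ω → NSI N} {x y : ℕ → Ω → Decision N}

/-- The cost of slot `t` as a random variable. -/
def pathCost (p : Params N) (s : ℕ → Ω → NSI N) (x : ℕ → Ω → Decision N) (t : ℕ) (ω : Ω) : ℝ :=
  slotCost p (fun i => pathQ p s x t i ω) (fun i => pathS p s x t i ω)
    (fun i => pathE p s x t i ω) (s t ω) (x t ω)

/-- The Lyapunov function at slot `t` as a random variable. -/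
def pathLyapunov (p : Params N) (s : ℕ → Ω → NSI N) (x : ℕ → Ω → Decision N) (t : ℕ) (ω : Ω) : ℝ :=
  lyapunov p (fun i => pathQ p s x t i ω) (fun i => pathS p s x t i ω)
    (fun i => pathE p s x t i ω)

namespace Admissible

variable (hx : Admissible P p s x) (hs : IsNetwork P p s)
include hx hs

lemma bddMeas_utility (t : ℕ) : BddMeas P fun ω => ∑ i, Real.log (1 + (x t ω).a i) :=
  .sum fun i _ => hx.bddMeas_log hs t i

lemma bddMeas_pathCost (t : ℕ) : BddMeas P (pathCost p s x t) := by
  refine ((((BddMeas.sum fun i _ => ?_).add (.sum fun i hi => ?_)).add (.sum fun i _ => ?_)).sub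
    (.sum fun i _ => ?_)).sub ((BddMeas.const _).mul (hx.bddMeas_utility hs t))
  · exact ((hx.bddMeas_pathS hs t i).sub (hx.bddMeas_pathQ hs t i)).mul (hx.bddMeas_rate hs t i)
  · exact ((hx.bddMeas_pathE hs t hi).sub (.const _)).mul
      ((hx.bddMeas_harvest hs t i).sub (hx.bddMeas_e t hi))
  · exact (hx.bddMeas_pathQ hs t i).mul (hx.bddMeas_a hs t i)
  · exact (hx.bddMeas_pathS hs t i).mul (hs.bddMeas_r t i)

lemma bddMeas_pathLyapunov (t : ℕ) : BddMeas P (pathLyapunov p s x t) := by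
  unfold pathLyapunov lyapunov
  simp only [pow_two]
  refine (BddMeas.const _).mul ((BddMeas.sum fun i _ => ?_).add (.sum fun i hi => ?_))
  · exact ((hx.bddMeas_pathQ hs t i).mul (hx.bddMeas_pathQ hs t i)).add
      ((hx.bddMeas_pathS hs t i).mul (hx.bddMeas_pathS hs t i))
  · exact ((hx.bddMeas_pathE hs t hi).sub (.const _)).mul
      ((hx.bddMeas_pathE hs t hi).sub (.const _))

lemma pathLyapunov_drift_le (t : ℕ) :
    ∀ᵐ ω ∂P, pathLyapunov p s x (t + 1) ω - pathLyapunov p s x t ω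
      ≤ B₁ p + pathCost p s x t ω + p.V * ∑ i, Real.log (1 + (x t ω).a i) := by
  filter_upwards [hs.h_nonneg t, hs.A_mem t, hs.r_mem t, hs.rate_le t, hs.harvest_le t, hx.time t,
    hx.power t, hx.collect t, hx.pathQ_nonneg t, hx.pathS_nonneg hs t, hx.pathE_le t]
    with ω h1 h2 h3 h4 h5 h6 h7 h8 h9 h10 h11
  have := lyapunov_update_le p h1 (fun i => (h2 i).2) h3 h6 h7 h8 (h4 _ h6 h7) (h5 _ h6) h9 h10 h11
    (fun i => pathQ_succ p s x t i ω) (fun i => pathS_succ p s x t i ω)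
    (fun i => pathE_succ p s x t i ω)
  unfold pathLyapunov pathCost slotCost
  linarith

/-- Uses `log (1 + a) ≤ a`. The bounds make the real-valued upper and lower limits meaningful. -/
lemma avgUtility_mem [IsProbabilityMeasure P] (t : ℕ) :
    avgUtility P x t ∈ Set.Icc 0 (∑ i, p.Amax i) := by
  have hlog : ∀ τ, ∀ᵐ ω ∂P, ∀ i, 0 ≤ Real.log (1 + (x τ ω).a i)
      ∧ Real.log (1 + (x τ ω).a i) ≤ p.Amax i := fun τ => ae_all_iff.2 fun i => hx.log_mem hs τ i
  have h0 : ∀ τ, 0 ≤ ∫ ω, ∑ i, Real.log (1 + (x τ ω).a i) ∂P := fun τ =>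
    integral_nonneg_of_ae ((hlog τ).mono fun ω h => Finset.sum_nonneg fun i _ => (h i).1)
  have h1 : ∀ τ, ∫ ω, ∑ i, Real.log (1 + (x τ ω).a i) ∂P ≤ ∑ i, p.Amax i := fun τ => by
    have := integral_mono_ae (hx.bddMeas_utility hs τ).integrable
      (integrable_const (∑ i, p.Amax i)) ((hlog τ).mono fun ω h => Finset.sum_le_sum fun i _ => (h i).2)
    simpa using this
  refine ⟨div_nonneg (Finset.sum_nonneg fun τ _ => h0 τ) t.cast_nonneg, ?_⟩
  -- This form covers `t = 0`, where the quotient is `0`; nonnegativity of the upper bound is read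
  -- off from slot `0`.
  refine div_le_of_le_mul₀ t.cast_nonneg ((h0 0).trans (h1 0)) ?_
  refine (Finset.sum_le_sum fun τ _ => h1 τ).trans (le_of_eq ?_)
  simp [mul_comm]

end Admissible

namespace IsERSRun

variable (hx : IsERSRun P p s x)
include hx

/-- Backlog nonnegativity and admissible collection support each other: the threshold rule needs `Q
≥ 0` to collect a nonnegative amount, which keeps the next `Q` nonnegative. Hence the induction. -/
lemma admissible (hs : IsNetwork P p s) : Admissible P p s x := by
  obtain ⟨⟨ℱ, hℱ⟩, hd⟩ := hx
  have hQ : ∀ t, ∀ᵐ ω ∂P, ∀ i, 0 ≤ pathQ p s x t i ω := by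
    intro t
    induction t with
    | zero => exact .of_forall fun _ i => p.Q₀_nonneg i
    | succ t ih =>
      filter_upwards [ih, hd t, hs.A_mem t] with ω h1 h2 h3 i
      exact add_nonneg (le_max_right _ _) (h2.collectOK h1 (fun i => (h3 i).1) i).1
  refine ⟨fun t => (hℱ t).2.1.mono (ℱ.le t) le_rfl, fun t => (hd t).mono fun ω h => h.timeOK,
    fun t => (hd t).mono fun ω h => h.powerOK, fun t => ?_⟩
  filter_upwards [hQ t, hd t, hs.A_mem t] with ω h1 h2 h3
  exact h2.collectOK h1 fun i => (h3 i).1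

/-- Backlogs at `t + 1` are functions of states and decisions up to `t`, hence `ℱ t`-measurable; the
initial values are constants. -/
lemma indepFun_path [IsProbabilityMeasure P] (t : ℕ) (i : Fin N) :
    IndepFun (pathQ p s x t i) (s t) P ∧ IndepFun (pathS p s x t i) (s t) P
      ∧ IndepFun (pathE p s x t i) (s t) P := by
  obtain ⟨ℱ, hℱ⟩ := hx.causal
  cases t with
  | zero => exact ⟨indepFun_const_left _ _, indepFun_const_left _ _, indepFun_const_left _ _⟩
  | succ t =>
    have h1 : ∀ τ < t + 1, Measurable[ℱ t] (s τ) := fun τ hτ =>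
      (hℱ τ).1.mono (ℱ.mono (Nat.lt_succ_iff.1 hτ)) le_rfl
    have h2 : ∀ τ < t + 1, Measurable[ℱ t] (x τ) := fun τ hτ =>
      (hℱ τ).2.1.mono (ℱ.mono (Nat.lt_succ_iff.1 hτ)) le_rfl
    have h3 : ∀ {f : Ω → ℝ}, Measurable[ℱ t] f → IndepFun f (s (t + 1)) P := fun hf =>
      (IndepFun_iff_Indep _ _ _).2 (indep_of_indep_of_le_left (hℱ t).2.2 hf.comap_le)
    exact ⟨h3 (@measurable_pathQ _ _ p s x (ℱ t) _ h1 h2 i),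
      h3 (@measurable_pathS _ _ p s x (ℱ t) _ h1 h2 i),
      h3 (@measurable_pathE _ _ p s x (ℱ t) _ h1 h2 i)⟩

/-- The expected cost of slot `t` under the algorithm is at most that of the decision which an
admissible process makes in slot `τ`, seen as independent of the current backlogs. -/
lemma integral_pathCost_le [IsProbabilityMeasure P] (hs : IsNetwork P p s)
    (hy : Admissible P p s y) (t τ : ℕ) :
    ∫ ω, pathCost p s x t ω ∂P
      ≤ ∑ i, (∫ ω, pathQ p s x t i ω ∂P) * ∫ ω, ((y τ ω).a i
          - min (rate p (s τ ω) (y τ ω) i) (pathQ p s y τ i ω)) ∂P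
        + ∑ i, (∫ ω, pathS p s x t i ω ∂P) * ∫ ω, (min (rate p (s τ ω) (y τ ω) i)
          (pathQ p s y τ i ω) - (s τ ω).r i) ∂P
        + ∑ i ∈ p.N₂, (∫ ω, (pathE p s x t i ω - p.θ i) ∂P)
          * ∫ ω, (harvest p (s τ ω) (y τ ω) i - (y τ ω).e i) ∂P
        + -p.V * ∫ ω, ∑ i, Real.log (1 + (y τ ω).a i) ∂P := by
  have hxa := hx.admissible hs
  -- All terms of the cost are put in the form weight times increment; the last summand carries the
  -- utility with constant weight `-V`.
  set X : Fin N ⊕ Fin N ⊕ p.N₂ ⊕ Unit → Ω → ℝ := Sum.elim (pathQ p s x t)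
    (Sum.elim (pathS p s x t) (Sum.elim (fun i ω => pathE p s x t i ω - p.θ i) fun _ _ => -p.V))
    with hXdef
  set b : Fin N ⊕ Fin N ⊕ p.N₂ ⊕ Unit → NSI N × (Decision N × (Fin N → ℝ)) → ℝ :=
    Sum.elim (fun i q => q.2.1.a i - q.2.2 i) (Sum.elim (fun i q => q.2.2 i - q.1.r i)
      (Sum.elim (fun i q => harvest p q.1 q.2.1 i - q.2.1.e i)
        fun _ q => ∑ i, Real.log (1 + q.2.1.a i))) with hbdef
  -- The amount really offloaded depends on the competitor's past backlog, not only on state and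
  -- decision of the slot, so it is transported as an extra coordinate.
  set Z : Ω → Decision N × (Fin N → ℝ) := fun ω =>
    (y τ ω, fun i => min (rate p (s τ ω) (y τ ω) i) (pathQ p s y τ i ω)) with hZdef
  have hlaw : ∀ t, P.map (s t) = P.map (s 0) := fun t => (hs.ident t).map_eq
  have hd : Measurable fun q : NSI N × (Decision N × (Fin N → ℝ)) => q.2.1 :=
    measurable_fst.comp measurable_snd
  have hm : ∀ i, Measurable fun q : NSI N × (Decision N × (Fin N → ℝ)) => q.2.2 i := fun i => by
    fun_prop
  have main := integral_le_of_indepFun (P := P) (X := X) (Y := s t) (Y' := s τ) (Z := Z)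
    (f := pathCost p s x t) (b := b) (R := admissibleSet p) ?_ (hs.meas t) (hs.meas τ) ?_
    ((hlaw t).trans (hlaw τ).symm) ?_ (measurableSet_admissibleSet p) ?_
    (hxa.bddMeas_pathCost hs t).integrable ?_ ?_ ?_
  · simp only [Fintype.sum_sum_type, hXdef, hbdef, hZdef, Sum.elim_inl, Sum.elim_inr,
      Finset.univ_unique, Finset.sum_singleton, integral_const, probReal_univ, one_smul] at main
    rw [Finset.sum_coe_sort p.N₂ fun i => (∫ ω, (pathE p s x t i ω - p.θ i) ∂P)
      * ∫ ω, (harvest p (s τ ω) (y τ ω) i - (y τ ω).e i) ∂P] at main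
    linarith
  · rintro (i | i | i | i)
    · exact (hxa.bddMeas_pathQ hs t i).integrable
    · exact (hxa.bddMeas_pathS hs t i).integrable
    · exact ((hxa.bddMeas_pathE hs t i.2).sub (.const _)).integrable
    · exact integrable_const _
  · exact (hy.meas τ).prodMk (measurable_pi_lambda _ fun i => (hy.bddMeas_min hs τ i).1)
  · rintro (i | i | i | i)
    · exact (hx.indepFun_path t i).1
    · exact (hx.indepFun_path t i).2.1
    · exact (hx.indepFun_path t i).2.2.comp (measurable_id.sub_const _) measurable_id
    · exact indepFun_const_left _ _
  · filter_upwards [hs.h_nonneg τ, hy.time τ, hy.power τ, hy.collect τ, hy.pathQ_nonneg τ]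
      with ω h1 h2 h3 h4 h5
    exact ⟨h2, h3, h4, fun i => ⟨le_min (rate_nonneg p h1 h2 h3 i) (h5 i), min_le_left _ _⟩⟩
  · rintro (i | i | i | i)
    · exact ((Decision.measurable_a i).comp hd).sub (hm i)
    · exact (hm i).sub ((NSI.measurable_r i).comp measurable_fst)
    · exact ((measurable_harvest p i).comp (measurable_fst.prodMk hd)).sub
        ((Decision.measurable_e (i : Fin N)).comp hd)
    · exact Finset.measurable_sum Finset.univ fun i _ => Real.measurable_log.comp
        (((Decision.measurable_a i).comp hd).const_add 1)
  · rintro (i | i | i | i)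
    · exact ((hy.bddMeas_a hs τ i).sub (hy.bddMeas_min hs τ i)).integrable
    · exact ((hy.bddMeas_min hs τ i).sub (hs.bddMeas_r τ i)).integrable
    · exact ((hy.bddMeas_harvest hs τ i).sub (hy.bddMeas_e τ i.2)).integrable
    · exact (hy.bddMeas_utility hs τ).integrable
  · filter_upwards [hx.decision t, hxa.pathQ_nonneg t, hxa.pathE_le t, hs.A_mem t]
      with ω h1 h2 h3 h4 z hz
    have h5 := h1.slotCost_le h2 h3 (fun i => (h4 i).1) hz
    simp only [Fintype.sum_sum_type, hXdef, hbdef, Sum.elim_inl, Sum.elim_inr,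
      Finset.univ_unique, Finset.sum_singleton]
    rw [Finset.sum_coe_sort p.N₂ fun i => (pathE p s x t i ω - p.θ i)
      * (harvest p (s t ω) z.1 i - z.1.e i)]
    refine le_trans h5 (le_of_eq ?_)
    simp only [pathQ, pathS, pathE]
    ring

/-- In every slot the expected cost of the algorithm is at most `-V` times the long-term utility of
any feasible offline process. -/
lemma integral_pathCost_le_limsup [IsProbabilityMeasure P] (hs : IsNetwork P p s)
    (hy : OfflineFeasible P p s y) (t : ℕ) :
    ∫ ω, pathCost p s x t ω ∂P ≤ -(p.V * limsup (avgUtility P y) atTop) := by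
  have hxa := hx.admissible hs
  have hya := hy.admissible
  have hV := p.V_pos
  set F := ∫ ω, pathCost p s x t ω ∂P
  set q : Fin N → ℝ := fun i => ∫ ω, pathQ p s x t i ω ∂P
  set r : Fin N → ℝ := fun i => ∫ ω, pathS p s x t i ω ∂P
  set e : Fin N → ℝ := fun i => ∫ ω, (pathE p s x t i ω - p.θ i) ∂P
  have hq : ∀ i, 0 ≤ q i := fun i =>
    integral_nonneg_of_ae ((hxa.pathQ_nonneg t).mono fun ω h => h i)
  have hr : ∀ i, 0 ≤ r i := fun i =>
    integral_nonneg_of_ae ((hxa.pathS_nonneg hs t).mono fun ω h => h i)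
  have he : ∀ i ∈ p.N₂, e i ≤ 0 := fun i hi =>
    integral_nonpos_of_ae ((hxa.pathE_le t).mono fun ω h => sub_nonpos.2 (h i hi))
  -- The telescoped remainder per slot: the terminal backlogs, and the uniform bound on the total
  -- energy loss, divided by `n`.
  set g : ℕ → ℝ := fun n => ∑ i, q i * ((∫ ω, pathQ p s y n i ω ∂P) / n)
    + ∑ i, r i * ((∫ ω, pathS p s y n i ω ∂P) / n)
    + ∑ i ∈ p.N₂, e i * (-(p.Pmax i * p.T + p.θ i) / n)
  have hg : Tendsto g atTop (nhds 0) := by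
    have h1 := tendsto_finsetSum Finset.univ fun i (_ : i ∈ Finset.univ) =>
      (hya.tendsto_integral_pathQ_div hs i (hy.stableQ i)).const_mul (q i)
    have h2 := tendsto_finsetSum Finset.univ fun i (_ : i ∈ Finset.univ) =>
      (hya.tendsto_integral_pathS_div hs i (hy.stableS i)).const_mul (r i)
    have h3 := tendsto_finsetSum p.N₂ fun i _ =>
      (tendsto_const_div_atTop_nhds_zero_nat (-(p.Pmax i * p.T + p.θ i))).const_mul (e i)
    simpa only [mul_zero, Finset.sum_const_zero, add_zero] using (h1.add h2).add h3
  have hle : ∀ᶠ n : ℕ in atTop, avgUtility P y n ≤ (g n - F) / p.V := by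
    filter_upwards [eventually_ge_atTop 1] with n hn
    have hn0 : (0 : ℝ) < n := by exact_mod_cast hn
    have hsum := Finset.sum_le_sum fun τ (_ : τ ∈ Finset.range n) =>
      hx.integral_pathCost_le hs hya t τ
    have hF : ∑ _τ ∈ Finset.range n, ∫ ω, pathCost p s x t ω ∂P = n * F := by simp [F]
    rw [hF] at hsum
    simp only [Finset.sum_add_distrib] at hsum
    rw [Finset.sum_comm, ← Finset.mul_sum,
      Finset.sum_comm (s := Finset.range n) (t := Finset.univ),
      Finset.sum_comm (s := Finset.range n) (t := p.N₂)] at hsum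
    simp only [← Finset.mul_sum] at hsum
    have k1 : ∑ i, q i * ∑ τ ∈ Finset.range n, ∫ ω, ((y τ ω).a i
        - min (rate p (s τ ω) (y τ ω) i) (pathQ p s y τ i ω)) ∂P
        ≤ ∑ i, q i * ∫ ω, pathQ p s y n i ω ∂P := by
      refine Finset.sum_le_sum fun i _ => mul_le_mul_of_nonneg_left ?_ (hq i)
      rw [hya.sum_integral_arrival_sub_departure hs]
      exact sub_le_self _ (p.Q₀_nonneg i)
    have k2 : ∑ i, r i * ∑ τ ∈ Finset.range n, ∫ ω, (min (rate p (s τ ω) (y τ ω) i)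
        (pathQ p s y τ i ω) - (s τ ω).r i) ∂P ≤ ∑ i, r i * ∫ ω, pathS p s y n i ω ∂P :=
      Finset.sum_le_sum fun i _ =>
        mul_le_mul_of_nonneg_left (hya.sum_integral_departure_sub_processed hs n i) (hr i)
    -- The nonpositive weight reverses the inequality, so a lower bound on net harvest is needed:
    -- terminal energy is at least `-Pmax T` and initial energy at most `θ`.
    have k3 : ∑ i ∈ p.N₂, e i * ∑ τ ∈ Finset.range n,
        ∫ ω, (harvest p (s τ ω) (y τ ω) i - (y τ ω).e i) ∂P
        ≤ ∑ i ∈ p.N₂, e i * -(p.Pmax i * p.T + p.θ i) := by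
      refine Finset.sum_le_sum fun i hi => mul_le_mul_of_nonpos_left ?_ (he i hi)
      refine le_trans ?_ (hya.integral_pathE_sub_le hs n hi)
      have h1 : ∫ _, -(p.Pmax i * p.T) ∂P ≤ ∫ ω, pathE p s y n i ω ∂P :=
        integral_mono_ae (integrable_const _) (hya.bddMeas_pathE hs n hi).integrable
          ((hy.pathE_ge n).mono fun ω h => h i hi)
      simp only [integral_const, probReal_univ, one_smul] at h1
      linarith [(p.E₀_mem i hi).2]
    have k4 : ∑ τ ∈ Finset.range n, ∫ ω, ∑ i, Real.log (1 + (y τ ω).a i) ∂P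
        = n * avgUtility P y n := by
      unfold avgUtility; field_simp
    have k5 : n * g n = ∑ i, q i * ∫ ω, pathQ p s y n i ω ∂P
        + ∑ i, r i * ∫ ω, pathS p s y n i ω ∂P
        + ∑ i ∈ p.N₂, e i * -(p.Pmax i * p.T + p.θ i) := by
      simp only [g, mul_add, Finset.mul_sum]
      congr 1
      · congr 1 <;> exact Finset.sum_congr rfl fun i _ => by field_simp
      · exact Finset.sum_congr rfl fun i _ => by field_simp
    rw [k4] at hsum
    rw [le_div_iff₀ hV]
    have k6 : (n : ℝ) * (avgUtility P y n * p.V) ≤ n * (g n - F) := by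
      rw [mul_sub, k5]
      linarith
    exact le_of_mul_le_mul_left k6 hn0
  have hlim : Tendsto (fun n => (g n - F) / p.V) atTop (nhds ((0 - F) / p.V)) :=
    (hg.sub_const F).div_const p.V
  have h := limsup_le_limsup hle
    (IsCoboundedUnder.of_frequently_ge (a := 0)
      (Frequently.of_forall fun n => (hya.avgUtility_mem hs n).1))
    hlim.isBoundedUnder_le
  rw [hlim.limsup_eq, le_div_iff₀ hV] at h
  linarith

/-- The averaged utility of the algorithm up to slot `t` is within `B₁ / V` and an error of order
`1 / t` of the long-term utility of any feasible offline process. -/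
lemma le_avgUtility [IsProbabilityMeasure P] (hs : IsNetwork P p s)
    (hy : OfflineFeasible P p s y) {t : ℕ} (ht : 1 ≤ t) :
    limsup (avgUtility P y) atTop - B₁ p / p.V - lyapunov p p.Q₀ p.S₀ p.E₀ / p.V / t
      ≤ avgUtility P x t := by
  have hxa := hx.admissible hs
  have hV := p.V_pos
  set u := limsup (avgUtility P y) atTop
  have hstep : ∀ τ, ∫ ω, pathLyapunov p s x (τ + 1) ω ∂P - ∫ ω, pathLyapunov p s x τ ω ∂P
      ≤ B₁ p - p.V * u + p.V * ∫ ω, ∑ i, Real.log (1 + (x τ ω).a i) ∂P := by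
    intro τ
    have hc := (hxa.bddMeas_pathCost hs τ).integrable
    have hu := (hxa.bddMeas_utility hs τ).integrable
    have h1 := integral_mono_ae ((hxa.bddMeas_pathLyapunov hs (τ + 1)).integrable.sub
      (hxa.bddMeas_pathLyapunov hs τ).integrable)
      (((integrable_const (B₁ p)).add hc).add (hu.const_mul p.V)) (hxa.pathLyapunov_drift_le hs τ)
    rw [integral_sub' (hxa.bddMeas_pathLyapunov hs (τ + 1)).integrable
      (hxa.bddMeas_pathLyapunov hs τ).integrable, integral_add' ((integrable_const _).add hc)
      (hu.const_mul p.V), integral_add' (integrable_const _) hc, integral_const_mul] at h1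
    simp only [integral_const, probReal_univ, one_smul] at h1
    linarith [hx.integral_pathCost_le_limsup hs hy τ]
  have hsum := Finset.sum_le_sum fun τ (_ : τ ∈ Finset.range t) => hstep τ
  rw [Finset.sum_range_sub (fun τ => ∫ ω, pathLyapunov p s x τ ω ∂P), Finset.sum_add_distrib,
    ← Finset.mul_sum] at hsum
  simp only [Finset.sum_const, Finset.card_range, nsmul_eq_mul] at hsum
  have hL0 : ∫ ω, pathLyapunov p s x 0 ω ∂P = lyapunov p p.Q₀ p.S₀ p.E₀ := by
    simp [pathLyapunov, pathQ, pathS, pathE, queueQ, queueS, energyE]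
  -- Nonnegativity of the terminal Lyapunov value lets the telescoped drift be bounded below by
  -- minus the initial value.
  have hLt : 0 ≤ ∫ ω, pathLyapunov p s x t ω ∂P :=
    integral_nonneg fun ω => lyapunov_nonneg p _ _ _
  have ht0 : (0 : ℝ) < t := by exact_mod_cast ht
  unfold avgUtility
  rw [le_div_iff₀ ht0]
  refine le_of_mul_le_mul_left ?_ hV
  have : p.V * ((u - B₁ p / p.V - lyapunov p p.Q₀ p.S₀ p.E₀ / p.V / t) * t)
      = t * (p.V * u - B₁ p) - lyapunov p p.Q₀ p.S₀ p.E₀ := by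
    field_simp
  rw [this]
  linarith

end IsERSRun


end

end

end WPMEC

theorem theorem2 {N : ℕ} (p : WPMEC.Params N)
    {Ω : Type*} [MeasurableSpace Ω] (P : Measure Ω) [IsProbabilityMeasure P]
    (s : ℕ → Ω → WPMEC.NSI N) (hs : WPMEC.IsNetwork P p s)
    (hfeas : ∃ y : ℕ → Ω → WPMEC.Decision N, WPMEC.OfflineFeasible P p s y)
    (x : ℕ → Ω → WPMEC.Decision N) (hx : WPMEC.IsERSRun P p s x) :
    WPMEC.offlineOptimum P p s - WPMEC.achievedUtility P x ≤ WPMEC.B₁ p / p.V := by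
  have hbound := (hx.admissible hs).avgUtility_mem hs
  rw [sub_le_iff_le_add]
  obtain ⟨y₀, hy₀⟩ := hfeas
  -- Feasibility makes the set nonempty, so the supremum is not a default value.
  refine csSup_le ⟨_, y₀, hy₀, rfl⟩ ?_
  rintro _ ⟨y, hy, rfl⟩
  have hlim : Tendsto (fun t : ℕ => limsup (WPMEC.avgUtility P y) atTop - WPMEC.B₁ p / p.V
      - WPMEC.lyapunov p p.Q₀ p.S₀ p.E₀ / p.V / t) atTop
      (nhds (limsup (WPMEC.avgUtility P y) atTop - WPMEC.B₁ p / p.V - 0)) :=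
    (tendsto_const_div_atTop_nhds_zero_nat _).const_sub _
  have h := liminf_le_liminf
    ((eventually_ge_atTop 1).mono fun t ht => hx.le_avgUtility hs hy ht)
    hlim.isBoundedUnder_ge
    (IsCoboundedUnder.of_frequently_le (a := ∑ i, p.Amax i)
      (Frequently.of_forall fun n => (hbound n).2))
  rw [hlim.liminf_eq] at h
  unfold WPMEC.achievedUtility
  linarith
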